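/- Let $\tfrac12<H<1$, $a>0$ and $T>0$. Let $B^H=(B^H_t)_{t\ge0}$ be a fractional Brownian motion with Hurst index $H$ on a probability space (a continuous centered Gaussian process with $E[B^H_tB^H_s]=\tfrac12(t^{2H}+s^{2H}-|t-s|^{2H})$), and let $X^H$ be the continuous solution on $[0,T]$ of $$X^H_t=B^H_t-a\int_0^t\int_0^s(X^H_s-X^H_u)\,du\,ds .$$ For $0\le s\le t$ put $h(t,s)=1-as\,e^{\frac12as^2}\int_s^te^{-\frac12au^2}\,du$, and let $w(s)=2H(2H-1)\int_0^sh(s,m)(s-m)^{2H-2}\,dm$. For $t\in[0,T]$ and $x\in\mathbb R$ define the local time and the weighted local time of $X^H$ by $$\mathscr L_t^x=\int_0^t\delta(X^H_s-x)\,ds=\lim_{\varepsilon\downarrow0}\frac1{2\varepsilon}\int_0^t1_{[x-\varepsilon,x+\varepsilon]}(X^H_s)\,ds,$$ $$\mathcal L_t^x=\int_0^tw(s)\,\delta(X^H_s-x)\,ds=\lim_{\varepsilon\downarrow0}\frac1{2\varepsilon}\int_0^tw(s)\,1_{[x-\varepsilon,x+\varepsilon]}(X^H_s)\,ds .$$ Then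 there is a constant $C>0$ depending only on $a$, $H$ and $T$ such that for every $t\in[0,T]$ and every $x\in\mathbb R$ both limits exist almost surely, $\mathscr L_t^x$ and $\mathcal L_t^x$ are square integrable, and $$E\big[(\mathscr L_t^x)^2\big]\le C\,t^{2-2H},\qquad E\big[(\mathcal L_t^x)^2\big]\le C\,t^{2H}.$$ -/

import Mathlib

open MeasureTheory ProbabilityTheory Filter Topology Set
open scoped NNReal

noncomputable section

namespace FracDiffusion

/-- `B` (indexed by real times, of which only `t ≥ 0` matter) is a fractional Brownian motion with
Hurst index `H` under `μ`: a continuous centered Gaussian process with covariance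
`(t ^ (2H) + s ^ (2H) - |t - s| ^ (2H)) / 2`. -/
structure IsFractionalBrownianMotion {Ω : Type*} [MeasurableSpace Ω]
    (H : ℝ) (B : ℝ → Ω → ℝ) (μ : Measure Ω) : Prop where
  gaussian : IsGaussianProcess (fun t : ℝ≥0 => B (t : ℝ)) μ
  centered : ∀ t : ℝ, 0 ≤ t → ∫ ω, B t ω ∂μ = 0
  covariance : ∀ t s : ℝ, 0 ≤ t → 0 ≤ s →
    ∫ ω, B t ω * B s ω ∂μ = (t ^ (2 * H) + s ^ (2 * H) - |t - s| ^ (2 * H)) / 2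
  continuous : ∀ᵐ ω ∂μ, ContinuousOn (fun t => B t ω) (Ici 0)

/-- `X` is a (continuous) solution on `[0, T]` of the linear self-attracting equation
`X_t = B_t - a ∫₀ᵗ ∫₀ˢ (X_s - X_u) du ds + ν t`. -/
structure IsSolution {Ω : Type*} [MeasurableSpace Ω]
    (a ν T : ℝ) (B X : ℝ → Ω → ℝ) (μ : Measure Ω) : Prop where
  aemeasurable : ∀ t ∈ Icc 0 T, AEMeasurable (X t) μ
  continuous : ∀ᵐ ω ∂μ, ContinuousOn (fun t => X t ω) (Icc 0 T)
  equation : ∀ᵐ ω ∂μ, ∀ t ∈ Icc 0 T,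
    X t ω = B t ω - a * (∫ s in (0 : ℝ)..t, ∫ u in (0 : ℝ)..s, (X s ω - X u ω)) + ν * t

/-- The kernel `h(t, s) = 1 - a s e^{a s² / 2} ∫ₛᵗ e^{-a u² / 2} du` for `t ≥ s`, and `0` for
`t < s`. -/
def kernelH (a t s : ℝ) : ℝ :=
  if s ≤ t then
    1 - a * s * Real.exp (a * s ^ 2 / 2) * ∫ u in s..t, Real.exp (-(a * u ^ 2 / 2))
  else 0

/-- The weight `s ↦ 2H(2H-1) ∫₀ˢ h(s, m) (s - m)^{2H-2} dm`. -/
def weight (a H s : ℝ) : ℝ :=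
  2 * H * (2 * H - 1) * ∫ m in (0 : ℝ)..s, kernelH a s m * (s - m) ^ (2 * H - 2)

/-- For a path `y`, the approximation
`(1 / 2ε) ∫₀ᵗ w(s) 1_{[x-ε, x+ε]}(y s) ds` of `∫₀ᵗ w(s) δ(y s - x) ds`. -/
def deltaApprox (w y : ℝ → ℝ) (t x ε : ℝ) : ℝ :=
  1 / (2 * ε) * ∫ s in (0 : ℝ)..t, w s * (Icc (x - ε) (x + ε)).indicator (fun _ => (1 : ℝ)) (y s)

/-- `∫₀ᵗ w(s) δ(y s - x) ds`, the limit of the approximations as `ε ↓ 0`. It is meaningful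
only when this limit exists. -/
def deltaIntegral (w y : ℝ → ℝ) (t x : ℝ) : ℝ :=
  limUnder (𝓝[>] (0 : ℝ)) (deltaApprox w y t x)

/-- The local time of `X` at level `x` up to time `t`. -/
def localTime {Ω : Type*} (X : ℝ → Ω → ℝ) (t x : ℝ) (ω : Ω) : ℝ :=
  deltaIntegral (fun _ => 1) (fun s => X s ω) t x

/-- The weighted local time of `X` at level `x` up to time `t`. -/
def weightedLocalTime {Ω : Type*} (a H : ℝ) (X : ℝ → Ω → ℝ) (t x : ℝ) (ω : Ω) : ℝ :=
  deltaIntegral (weight a H) (fun s => X s ω) t x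

end FracDiffusion

end

/-! The second moment of a local time is a double time integral of two-point densities, so the
bounds follow from local nondeterminism: for `0 < r < s ≤ T` the variance of `X_r` is at least `b²
r^(2H)`, and the residual of `X_s` after regression on `X_r` has variance at least `b² (s -
r)^(2H)`. The two-point density is then at most `b⁻² r^(-H) (s - r)^(-H)`, which is integrable
because `H < 1`, and its integral over `0 < r < s ≤ t` is of order `t^(2-2H)`. For the weighted
local time, `0 ≤ w ≤ 2H t^(2H-1)` on `(0, t]` contributes a further factor `t^(4H-2)`.

Nondeterminism is proved in `L²(ℝ)`. The equation is solved explicitly as a Volterra transform of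
`B` (`solution_formula`), and fractional Brownian motion has the covariance of the moving averages
`(t - z)₊^α - (-z)₊^α`, `α = H - 1/2`, up to the factor `fracConst α`. Thus `X_t` corresponds to a
vector `solVec`. Pairing with the indicator of `(r, s]` annihilates the vector of `X_r` and has an
explicit lower bound at `X_s`, since the kernel `h` is bounded below by `e^(-aT²/2)`; Cauchy–Schwarz
concludes (`le_norm_solVec_sub`). Riemann sums and characteristic functions transfer this to the
laws of pairs (`map_volterra_combination`, `map_regression`).

For the limit `ε ↓ 0`, Hölder continuity of the Gaussian density costs a small extra power of `s -
r` and gives a power rate in `L²` for differences of approximations. This yields almost sure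
convergence along `ε = n^(-P)`, and monotonicity of `ε ↦ ε F_ε` extends it to all `ε`
(`exists_limit_of_sq_rate`). -/

noncomputable section

namespace FracDiffusion

/-! ### The kernel `h`, its derivative and its bounds. -/

/-- The Gaussian integral `∫ᵤᵗ e^{-a v² / 2} dv`. -/
def gaussInt (a t u : ℝ) : ℝ := ∫ v in u..t, Real.exp (-(a * v ^ 2 / 2))

/-- The smooth function of `u` that agrees with `kernelH a t` on `u ≤ t`. -/
def smoothKernel (a t u : ℝ) : ℝ := 1 - a * u * Real.exp (a * u ^ 2 / 2) * gaussInt a t u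

/-- The kernel `-∂ᵤ h(t, u)` of the representation `X_t = B_t + ∫₀ᵗ k(t, u) B_u du`. -/
def volterraKernel (a t u : ℝ) : ℝ :=
  a * (1 + a * u ^ 2) * Real.exp (a * u ^ 2 / 2) * gaussInt a t u - a * u

lemma continuous_exp_neg_sq (a : ℝ) : Continuous fun v : ℝ => Real.exp (-(a * v ^ 2 / 2)) := by
  fun_prop

lemma hasDerivAt_gaussInt (a t u : ℝ) :
    HasDerivAt (gaussInt a t) (-Real.exp (-(a * u ^ 2 / 2))) u :=
  intervalIntegral.integral_hasDerivAt_left ((continuous_exp_neg_sq a).intervalIntegrable _ _)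
    ((continuous_exp_neg_sq a).stronglyMeasurableAtFilter _ _)
    (continuous_exp_neg_sq a).continuousAt

lemma continuous_gaussInt (a t : ℝ) : Continuous (gaussInt a t) :=
  continuous_iff_continuousAt.2 fun u => (hasDerivAt_gaussInt a t u).continuousAt

@[simp] lemma gaussInt_self (a t : ℝ) : gaussInt a t t = 0 := intervalIntegral.integral_same

lemma gaussInt_nonneg {a t u : ℝ} (h : u ≤ t) : 0 ≤ gaussInt a t u :=
  intervalIntegral.integral_nonneg h fun _ _ => (Real.exp_pos _).le

lemma gaussInt_eq_sub (a t u : ℝ) : gaussInt a t u = gaussInt a t 0 - gaussInt a u 0 :=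
  (intervalIntegral.integral_interval_sub_left
    ((continuous_exp_neg_sq a).intervalIntegrable _ _)
    ((continuous_exp_neg_sq a).intervalIntegrable _ _)).symm

lemma continuous_volterraKernel (a t : ℝ) : Continuous (volterraKernel a t) := by
  have := continuous_gaussInt a t
  unfold volterraKernel
  fun_prop

lemma hasDerivAt_exp_sq (a u : ℝ) :
    HasDerivAt (fun u : ℝ => Real.exp (a * u ^ 2 / 2)) (a * u * Real.exp (a * u ^ 2 / 2)) u := by
  have h : HasDerivAt (fun u : ℝ => a * u ^ 2 / 2) (a * u) u := by
    have := ((hasDerivAt_pow 2 u).const_mul a).div_const 2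
    refine this.congr_deriv ?_
    push_cast
    ring
  exact h.exp.congr_deriv (by ring)

lemma exp_sq_mul_exp_neg_sq (a u : ℝ) :
    Real.exp (a * u ^ 2 / 2) * Real.exp (-(a * u ^ 2 / 2)) = 1 := by
  rw [← Real.exp_add, add_neg_cancel, Real.exp_zero]

lemma hasDerivAt_smoothKernel (a t u : ℝ) :
    HasDerivAt (smoothKernel a t) (-volterraKernel a t u) u := by
  have h := (((((hasDerivAt_id u).const_mul a).mul (hasDerivAt_exp_sq a u)).mul
    (hasDerivAt_gaussInt a t u)).const_sub 1)
  refine h.congr_deriv ?_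
  have e := exp_sq_mul_exp_neg_sq a u
  simp only [id, Pi.mul_apply, volterraKernel]
  linear_combination a * u * e

lemma continuous_smoothKernel (a t : ℝ) : Continuous (smoothKernel a t) :=
  continuous_iff_continuousAt.2 fun u => (hasDerivAt_smoothKernel a t u).continuousAt

@[simp] lemma smoothKernel_self (a t : ℝ) : smoothKernel a t t = 1 := by simp [smoothKernel]

lemma kernelH_of_le {a t u : ℝ} (h : u ≤ t) : kernelH a t u = smoothKernel a t u := by
  simp [kernelH, h, smoothKernel, gaussInt]

lemma smoothKernel_le_one {a t u : ℝ} (ha : 0 < a) (hu : 0 ≤ u) (h : u ≤ t) :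
    smoothKernel a t u ≤ 1 := by
  have := gaussInt_nonneg (a := a) h
  have h2 : 0 ≤ a * u * Real.exp (a * u ^ 2 / 2) * gaussInt a t u := by positivity
  unfold smoothKernel
  linarith

/-- Replacing the factor `u` by the integration variable `v ≥ u` makes the integrand an exact
derivative. -/
lemma mul_gaussInt_le {a t u : ℝ} (ha : 0 < a) (h : u ≤ t) :
    a * u * gaussInt a t u ≤ Real.exp (-(a * u ^ 2 / 2)) - Real.exp (-(a * t ^ 2 / 2)) := by
  have h1 : ∫ v in u..t, a * v * Real.exp (-(a * v ^ 2 / 2)) =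
      Real.exp (-(a * u ^ 2 / 2)) - Real.exp (-(a * t ^ 2 / 2)) := by
    rw [intervalIntegral.integral_eq_sub_of_hasDerivAt
      (f := fun v => -Real.exp (-(a * v ^ 2 / 2)))]
    · ring
    · intro v _
      have := (hasDerivAt_exp_sq (-a) v).neg
      have e : ∀ v : ℝ, -a * v ^ 2 / 2 = -(a * v ^ 2 / 2) := fun v => by ring
      simp only [e] at this
      exact this.congr_deriv (by ring)
    · exact Continuous.intervalIntegrable (by fun_prop) _ _
  rw [← h1, gaussInt, ← intervalIntegral.integral_const_mul]
  refine intervalIntegral.integral_mono_on h (Continuous.intervalIntegrable (by fun_prop) _ _)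
    (Continuous.intervalIntegrable (by fun_prop) _ _) fun v hv => ?_
  have := hv.1
  gcongr

/-- By `mul_gaussInt_le` the kernel is at least `e^(a(u² - t²)/2)`. This lower bound, uniform in
`u`, is what keeps the drift from destroying the nondeterminism of the noise. -/
lemma exp_le_smoothKernel {a t u : ℝ} (ha : 0 < a) (h : u ≤ t) :
    Real.exp (-(a * t ^ 2 / 2)) ≤ smoothKernel a t u := by
  have h1 := mul_gaussInt_le ha h
  have e := exp_sq_mul_exp_neg_sq a u
  have h2 : Real.exp (a * u ^ 2 / 2) * (a * u * gaussInt a t u) ≤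
      1 - Real.exp (a * u ^ 2 / 2) * Real.exp (-(a * t ^ 2 / 2)) := by
    have := mul_le_mul_of_nonneg_left h1 (Real.exp_pos (a * u ^ 2 / 2)).le
    rw [mul_sub, e] at this
    exact this
  have h3 : Real.exp (-(a * t ^ 2 / 2)) ≤
      Real.exp (a * u ^ 2 / 2) * Real.exp (-(a * t ^ 2 / 2)) :=
    le_mul_of_one_le_left (Real.exp_pos _).le (Real.one_le_exp (by positivity))
  have h4 : smoothKernel a t u = 1 - Real.exp (a * u ^ 2 / 2) * (a * u * gaussInt a t u) := by
    unfold smoothKernel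
    ring
  linarith

/-! ### Explicit solution of the equation. -/

/-- A continuous solution of `x = b - a ∫ ∫ (x_s - x_u) du ds` is a Volterra transform of `b`. -/
lemma solution_formula {a T : ℝ} {b x : ℝ → ℝ} (hx : ContinuousOn x (Icc 0 T))
    (heq : ∀ t ∈ Icc 0 T, x t = b t - a * ∫ s in (0 : ℝ)..t, ∫ u in (0 : ℝ)..s, (x s - x u))
    {t : ℝ} (ht : t ∈ Icc 0 T) :
    x t = b t + ∫ u in (0 : ℝ)..t, volterraKernel a t u * b u := by
  have hT : 0 ≤ T := ht.1.trans ht.2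
  obtain ⟨y, hy, hyx⟩ : ∃ y : ℝ → ℝ, Continuous y ∧ ∀ s ∈ Icc 0 T, y s = x s :=
    ⟨IccExtend hT ((Icc 0 T).domRestrict x), (continuousOn_iff_continuous_domRestrict.1 hx).Icc_extend',
      fun s hs => by rw [IccExtend_of_mem _ _ hs]; rfl⟩
  set I : ℝ → ℝ := fun s => ∫ u in (0 : ℝ)..s, y u with hI
  have hI' : ∀ s, HasDerivAt I (y s) s := fun s => hy.integral_hasStrictDerivAt 0 s |>.hasDerivAt
  have hIc : Continuous I := continuous_iff_continuousAt.2 fun s => (hI' s).continuousAt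
  -- `g s` is the inner integral of the equation, so the equation reads `b = y + a G`.
  set g : ℝ → ℝ := fun s => s * y s - I s with hg
  have hgc : Continuous g := by fun_prop
  set G : ℝ → ℝ := fun s => ∫ u in (0 : ℝ)..s, g u with hG
  have hG' : ∀ s, HasDerivAt G (g s) s := fun s => hgc.integral_hasStrictDerivAt 0 s |>.hasDerivAt
  have hGc : Continuous G := continuous_iff_continuousAt.2 fun s => (hG' s).continuousAt
  have hb : ∀ s ∈ Icc 0 T, b s = y s + a * G s := by
    intro s hs
    have h1 : ∫ r in (0 : ℝ)..s, ∫ u in (0 : ℝ)..r, (x r - x u) = G s := by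
      refine intervalIntegral.integral_congr fun r hr => ?_
      rw [uIcc_of_le hs.1] at hr
      have hrT : r ∈ Icc 0 T := ⟨hr.1, hr.2.trans hs.2⟩
      have h2 : ∫ u in (0 : ℝ)..r, (x r - x u) = ∫ u in (0 : ℝ)..r, (y r - y u) := by
        refine intervalIntegral.integral_congr fun u hu => ?_
        rw [uIcc_of_le hr.1] at hu
        simp only [hyx r hrT, hyx u ⟨hu.1, hu.2.trans hrT.2⟩]
      simp only [h2, hg, hI]
      rw [intervalIntegral.integral_sub (continuous_const.intervalIntegrable _ _)
        (hy.intervalIntegrable _ _)]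
      simp
    have := heq s hs
    rw [h1] at this
    rw [hyx s hs]
    linarith
  have hint : ∫ u in (0 : ℝ)..t, volterraKernel a t u * b u =
      ∫ u in (0 : ℝ)..t, volterraKernel a t u * (y u + a * G u) := by
    refine intervalIntegral.integral_congr fun u hu => ?_
    rw [uIcc_of_le ht.1] at hu
    simp only [hb u ⟨hu.1, hu.2.trans ht.2⟩]
  -- The integrand has an explicit primitive. The correction containing `I` cancels the `I` part of
  -- `g`; it vanishes at both ends, since `I 0 = 0` and `gaussInt a t t = 0`.
  have hFTC : ∫ u in (0 : ℝ)..t, volterraKernel a t u * (y u + a * G u) = -a * G t := by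
    rw [intervalIntegral.integral_eq_sub_of_hasDerivAt
      (f := fun u => -a * (smoothKernel a t u * G u) +
        a * (Real.exp (a * u ^ 2 / 2) * gaussInt a t u * I u))]
    · simp [hG, hI]
    · intro u _
      have h := (((hasDerivAt_smoothKernel a t u).mul (hG' u)).const_mul (-a)).add
        ((((hasDerivAt_exp_sq a u).mul (hasDerivAt_gaussInt a t u)).mul (hI' u)).const_mul a)
      refine h.congr_deriv ?_
      have e := exp_sq_mul_exp_neg_sq a u
      simp only [hg, smoothKernel, volterraKernel, Pi.mul_apply]
      linear_combination (-a * I u) * e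
    · have := continuous_volterraKernel a t
      exact Continuous.intervalIntegrable (by fun_prop) _ _
  rw [hint, hFTC, hb t ht, hyx t ht]
  ring

/-! ### Measurability and bounds of the weight. -/

lemma measurable_intervalIntegral_zero {f : ℝ → ℝ → ℝ} (hf : Measurable (Function.uncurry f)) :
    Measurable fun s => ∫ m in (0 : ℝ)..s, f s m := by
  have key : ∀ S : Set (ℝ × ℝ), MeasurableSet S →
      Measurable fun s : ℝ => ∫ m, S.indicator (Function.uncurry f) (s, m) := fun S hS =>
    ((hf.indicator hS).stronglyMeasurable.integral_prod_right').measurable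
  have h1 := key {p | 0 < p.2 ∧ p.2 ≤ p.1}
    ((measurableSet_lt measurable_const measurable_snd).inter
      (measurableSet_le measurable_snd measurable_fst))
  have h2 := key {p | p.1 < p.2 ∧ p.2 ≤ 0}
    ((measurableSet_lt measurable_fst measurable_snd).inter
      (measurableSet_le measurable_snd measurable_const))
  convert h1.sub h2 using 2 with s
  rw [intervalIntegral, ← integral_indicator measurableSet_Ioc, ← integral_indicator measurableSet_Ioc]
  congr 1

lemma measurable_uncurry_kernelH (a : ℝ) : Measurable (Function.uncurry (kernelH a)) := by
  unfold Function.uncurry kernelH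
  refine Measurable.ite (measurableSet_le measurable_snd measurable_fst) ?_ measurable_const
  have h : ∀ p : ℝ × ℝ, ∫ u in p.2..p.1, Real.exp (-(a * u ^ 2 / 2)) =
      gaussInt a 0 p.2 - gaussInt a 0 p.1 := fun p => by
    have h1 : ∀ x, gaussInt a 0 x = -gaussInt a x 0 := fun x => intervalIntegral.integral_symm _ _
    rw [h1, h1, ← gaussInt, gaussInt_eq_sub]
    ring
  simp only [h]
  have := continuous_gaussInt a 0
  exact Continuous.measurable (by fun_prop)

lemma measurable_weight (a H : ℝ) : Measurable (weight a H) := by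
  refine (measurable_intervalIntegral_zero ?_).const_mul _
  exact (measurable_uncurry_kernelH a).mul
    ((measurable_fst.sub measurable_snd).pow_const (2 * H - 2))

lemma intervalIntegrable_sub_rpow {p s : ℝ} (hp : -1 < p) :
    IntervalIntegrable (fun m : ℝ => (s - m) ^ p) volume 0 s := by
  have := (intervalIntegral.intervalIntegrable_rpow' (a := s) (b := 0) hp).comp_sub_left s
  simpa using this

lemma integral_sub_rpow {p s : ℝ} (hp : -1 < p) :
    ∫ m in (0 : ℝ)..s, (s - m) ^ p = s ^ (p + 1) / (p + 1) := by
  rw [intervalIntegral.integral_comp_sub_left (fun x : ℝ => x ^ p), integral_rpow (Or.inl hp)]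
  simp [Real.zero_rpow (show p + 1 ≠ 0 by linarith)]

lemma weight_nonneg {a H s : ℝ} (ha : 0 < a) (hH : 1 / 2 < H) (hs : 0 ≤ s) :
    0 ≤ weight a H s := by
  refine mul_nonneg (mul_nonneg (by linarith) (by linarith))
    (intervalIntegral.integral_nonneg hs fun m hm => ?_)
  rw [kernelH_of_le hm.2]
  exact mul_nonneg ((Real.exp_pos _).le.trans (exp_le_smoothKernel ha hm.2))
    (Real.rpow_nonneg (sub_nonneg.2 hm.2) _)

/-- Since `h ≤ 1`, the integral is at most that of `(s - m)^(2H-2)`, whose factor `1 / (2H - 1)`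
cancels the prefactor. -/
lemma weight_le {a H s : ℝ} (ha : 0 < a) (hH : 1 / 2 < H) (hs : 0 ≤ s) :
    weight a H s ≤ 2 * H * s ^ (2 * H - 1) := by
  have hp : -1 < 2 * H - 2 := by linarith
  have h1 : ∫ m in (0 : ℝ)..s, kernelH a s m * (s - m) ^ (2 * H - 2) ≤
      ∫ m in (0 : ℝ)..s, (s - m) ^ (2 * H - 2) := by
    have hi : IntervalIntegrable (fun m => smoothKernel a s m * (s - m) ^ (2 * H - 2)) volume 0 s :=
      (intervalIntegrable_sub_rpow hp).continuousOn_mul (continuous_smoothKernel a s).continuousOn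
    refine intervalIntegral.integral_mono_on hs (hi.congr fun m hm => ?_)
      (intervalIntegrable_sub_rpow hp) fun m hm => ?_
    · rw [uIoc_of_le hs] at hm
      simp only [kernelH_of_le hm.2]
    · rw [kernelH_of_le hm.2]
      exact mul_le_of_le_one_left (Real.rpow_nonneg (sub_nonneg.2 hm.2) _)
        (smoothKernel_le_one ha hm.1 hm.2)
  rw [integral_sub_rpow hp, show 2 * H - 2 + 1 = 2 * H - 1 by ring] at h1
  calc weight a H s ≤ 2 * H * (2 * H - 1) * (s ^ (2 * H - 1) / (2 * H - 1)) :=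
        mul_le_mul_of_nonneg_left h1 (mul_nonneg (by linarith) (by linarith))
    _ = 2 * H * s ^ (2 * H - 1) := by
        have : 2 * H - 1 ≠ 0 := by linarith
        field_simp

/-! ### Moving average representation of fractional Brownian motion in `L²(ℝ)`. -/

/-- The moving average kernel `(t - z)₊^α - (-z)₊^α` of fractional Brownian motion. -/
def fracKernel (α t z : ℝ) : ℝ := max (t - z) 0 ^ α - max (-z) 0 ^ α

lemma continuous_fracKernel {α : ℝ} (hα : 0 < α) (t : ℝ) : Continuous (fracKernel α t) := by
  unfold fracKernel
  refine Continuous.sub ?_ ?_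
  · exact Continuous.rpow_const (by fun_prop) fun _ => Or.inr hα.le
  · exact Continuous.rpow_const (by fun_prop) fun _ => Or.inr hα.le

lemma fracKernel_sub (α t s z : ℝ) :
    fracKernel α t z - fracKernel α s z = fracKernel α (t - s) (z - s) := by
  simp only [fracKernel]
  rw [show t - s - (z - s) = t - z by ring, show -(z - s) = s - z by ring]
  ring

lemma fracKernel_neg (α t z : ℝ) : fracKernel α (-t) z = -fracKernel α t (z + t) := by
  simp only [fracKernel]
  rw [show t - (z + t) = -z by ring, show -(z + t) = -t - z by ring]
  ring

@[simp] lemma fracKernel_zero (α z : ℝ) : fracKernel α 0 z = 0 := by simp [fracKernel]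

lemma fracKernel_mul {α t : ℝ} (ht : 0 < t) (z : ℝ) :
    fracKernel α t (t * z) = t ^ α * fracKernel α 1 z := by
  have h : ∀ x : ℝ, max (t * x) 0 = t * max x 0 := fun x => by
    rw [mul_max_of_nonneg _ _ ht.le, mul_zero]
  simp only [fracKernel]
  rw [show t - t * z = t * (1 - z) by ring, show -(t * z) = t * -z by ring, h, h,
    Real.mul_rpow ht.le (le_max_right _ _), Real.mul_rpow ht.le (le_max_right _ _)]
  ring

/-- Bernoulli's inequality `(1 + x)^α ≤ 1 + αx` with `x = t / (-z)`. The resulting decay is square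
integrable at `-∞` exactly when `α < 1/2`. -/
lemma abs_fracKernel_le {α t z : ℝ} (hα : 0 < α) (hα1 : α < 1) (ht : 0 ≤ t) (hz : z < 0) :
    |fracKernel α t z| ≤ α * t * (-z) ^ (α - 1) := by
  have hy : 0 < -z := by linarith
  have h1 : max (t - z) 0 = -z * (1 + t / -z) := by
    rw [max_eq_left (by linarith)]
    rw [mul_add, mul_div_cancel₀ _ hy.ne']
    ring
  have h2 : 0 ≤ t / -z := by positivity
  have h3 := rpow_one_add_le_one_add_mul_self (s := t / -z) (by linarith) hα.le hα1.le
  have h4 : (1 : ℝ) ≤ (1 + t / -z) ^ α := Real.one_le_rpow (by linarith) hα.le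
  have h5 : fracKernel α t z = (-z) ^ α * ((1 + t / -z) ^ α - 1) := by
    simp only [fracKernel]
    rw [h1, max_eq_left hy.le, Real.mul_rpow hy.le (by linarith)]
    ring
  have h6 : 0 ≤ (-z) ^ α := by positivity
  rw [h5, abs_of_nonneg (mul_nonneg h6 (by linarith)), Real.rpow_sub_one hy.ne']
  calc (-z) ^ α * ((1 + t / -z) ^ α - 1) ≤ (-z) ^ α * (α * (t / -z)) :=
        mul_le_mul_of_nonneg_left (by linarith) h6
    _ = _ := by ring

lemma memLp_fracKernel_of_nonneg {α t : ℝ} (hα : 0 < α) (hα1 : α < 1 / 2) (ht : 0 ≤ t) :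
    MemLp (fracKernel α t) 2 volume := by
  have hc := continuous_fracKernel hα t
  rw [memLp_two_iff_integrable_sq hc.aestronglyMeasurable]
  have h1 : IntegrableOn (fun z => fracKernel α t z ^ 2) (Iic (-1)) := by
    have hg : IntegrableOn (fun z : ℝ => (α * t) ^ 2 * (-z) ^ (2 * α - 2)) (Iic (-1)) := by
      refine Integrable.const_mul ?_ _
      have := integrableOn_Ioi_rpow_of_lt (a := 2 * α - 2) (c := 1) (by linarith) one_pos
      rw [← integrableOn_Ici_iff_integrableOn_Ioi] at this
      have h2 := (Measure.measurePreserving_neg (volume : Measure ℝ)).integrableOn_comp_preimage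
        (Homeomorph.neg ℝ).measurableEmbedding (s := Ici 1) (f := fun z : ℝ => z ^ (2 * α - 2))
      have h3 := h2.2 this
      simpa [Function.comp_def, IntegrableOn] using h3
    refine hg.mono' (hc.pow 2).aestronglyMeasurable
      ((ae_restrict_mem measurableSet_Iic).mono fun z hz => ?_)
    have hz' : z < 0 := lt_of_le_of_lt hz (by norm_num)
    have h4 := abs_fracKernel_le hα (by linarith) ht hz'
    rw [Real.norm_of_nonneg (sq_nonneg _), ← sq_abs]
    calc |fracKernel α t z| ^ 2 ≤ (α * t * (-z) ^ (α - 1)) ^ 2 :=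
          pow_le_pow_left₀ (abs_nonneg _) h4 2
      _ = _ := by
          rw [mul_pow, ← Real.rpow_natCast ((-z) ^ (α - 1)), ← Real.rpow_mul (by linarith)]
          congr 2
          push_cast
          ring
  have h2 : IntegrableOn (fun z => fracKernel α t z ^ 2) (Icc (-1) t) :=
    (hc.pow 2).continuousOn.integrableOn_Icc
  have h3 : IntegrableOn (fun z => fracKernel α t z ^ 2) (Ici t) := by
    refine (integrableOn_zero).congr_fun (fun z hz => ?_) measurableSet_Ici
    have hz' : t ≤ z := hz
    simp only [fracKernel]
    rw [max_eq_right (by linarith), max_eq_right (by linarith)]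
    simp
  rw [← integrableOn_univ, ← Iic_union_Ici (a := t),
    ← Iic_union_Icc_eq_Iic (show (-1 : ℝ) ≤ t by linarith)]
  exact (h1.union h2).union h3

lemma memLp_fracKernel {α : ℝ} (hα : 0 < α) (hα1 : α < 1 / 2) (t : ℝ) :
    MemLp (fracKernel α t) 2 volume := by
  rcases le_total 0 t with ht | ht
  · exact memLp_fracKernel_of_nonneg hα hα1 ht
  · have h := (memLp_fracKernel_of_nonneg hα hα1 (neg_nonneg.2 ht)).comp_measurePreserving
      (measurePreserving_add_right volume (-t))
    convert h.neg using 1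
    ext z
    have := fracKernel_neg α (-t) z
    rw [neg_neg] at this
    simpa using this

/-- The squared `L²` norm of the kernel at time one. -/
def fracConst (α : ℝ) : ℝ := ∫ z, fracKernel α 1 z ^ 2

/-- Self-similarity: the substitution `z ↦ t z` reduces to time one. -/
lemma integral_fracKernel_sq_of_pos {α t : ℝ} (ht : 0 < t) :
    ∫ z, fracKernel α t z ^ 2 = fracConst α * t ^ (2 * α + 1) := by
  have h := Measure.integral_comp_mul_left (fun z => fracKernel α t z ^ 2) t
  simp only [fracKernel_mul ht, mul_pow, integral_const_mul, smul_eq_mul] at h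
  rw [abs_of_pos (inv_pos.2 ht), ← fracConst] at h
  rw [Real.rpow_add ht, Real.rpow_one, mul_comm 2 α, Real.rpow_mul ht.le]
  simp only [Real.rpow_two]
  field_simp at h
  linarith

lemma integral_fracKernel_sq {α : ℝ} (hα : 0 < α) (t : ℝ) :
    ∫ z, fracKernel α t z ^ 2 = fracConst α * |t| ^ (2 * α + 1) := by
  rcases lt_trichotomy t 0 with ht | rfl | ht
  · have h : ∀ z, fracKernel α t z ^ 2 = fracKernel α (-t) (z + -t) ^ 2 := fun z => by
      have := fracKernel_neg α (-t) z
      rw [neg_neg] at this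
      rw [this, neg_sq]
    simp only [h]
    rw [integral_add_right_eq_self (fun z => fracKernel α (-t) z ^ 2),
      integral_fracKernel_sq_of_pos (neg_pos.2 ht), abs_of_neg ht]
  · simp [Real.zero_rpow (show 2 * α + 1 ≠ 0 by linarith)]
  · rw [integral_fracKernel_sq_of_pos ht, abs_of_pos ht]

lemma norm_toLp_sq {f : ℝ → ℝ} (hf : MemLp f 2 (volume : Measure ℝ)) :
    ‖hf.toLp f‖ ^ 2 = ∫ z, f z ^ 2 := by
  rw [← real_inner_self_eq_norm_sq, L2.inner_def]
  refine integral_congr_ae ?_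
  filter_upwards [hf.coeFn_toLp] with z hz
  simp only [hz, real_inner_self_eq_norm_sq, Real.norm_eq_abs, sq_abs]

/-- The moving average kernel as an element of `L²(ℝ)`. -/
def fracVec {α : ℝ} (hα : 0 < α) (hα1 : α < 1 / 2) (t : ℝ) : Lp ℝ 2 (volume : Measure ℝ) :=
  (memLp_fracKernel hα hα1 t).toLp _

section

variable {α : ℝ} (hα : 0 < α) (hα1 : α < 1 / 2)

lemma norm_fracVec_sq (t : ℝ) :
    ‖fracVec hα hα1 t‖ ^ 2 = fracConst α * |t| ^ (2 * α + 1) := by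
  rw [fracVec, norm_toLp_sq, integral_fracKernel_sq hα]

lemma norm_fracVec_sub_sq (t s : ℝ) :
    ‖fracVec hα hα1 t - fracVec hα hα1 s‖ ^ 2 = fracConst α * |t - s| ^ (2 * α + 1) := by
  rw [fracVec, fracVec, ← MemLp.toLp_sub, norm_toLp_sq, ← integral_fracKernel_sq hα]
  simp only [Pi.sub_apply, fracKernel_sub]
  exact integral_sub_right_eq_self (fun z => fracKernel α (t - s) z ^ 2) s

/-- Polarization: only the norms of the vectors and of their stationary increments enter. With `2α +
1 = 2H` this is the covariance of `B` times `fracConst α`. -/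
lemma inner_fracVec (t s : ℝ) :
    inner ℝ (fracVec hα hα1 t) (fracVec hα hα1 s) =
      fracConst α * ((|t| ^ (2 * α + 1) + |s| ^ (2 * α + 1) - |t - s| ^ (2 * α + 1)) / 2) := by
  have h := norm_sub_sq_real (fracVec hα hα1 t) (fracVec hα hα1 s)
  rw [norm_fracVec_sub_sq, norm_fracVec_sq, norm_fracVec_sq] at h
  linarith

lemma continuous_fracVec : Continuous (fracVec hα hα1) := by
  rw [continuous_iff_continuousAt]
  intro s
  rw [ContinuousAt, tendsto_iff_norm_sub_tendsto_zero]
  have h : ∀ t, ‖fracVec hα hα1 t - fracVec hα hα1 s‖ =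
      √(fracConst α * |t - s| ^ (2 * α + 1)) := fun t => by
    rw [← norm_fracVec_sub_sq hα hα1, Real.sqrt_sq (norm_nonneg _)]
  simp only [h]
  have hc : Continuous fun t : ℝ => √(fracConst α * |t - s| ^ (2 * α + 1)) := by
    refine Real.continuous_sqrt.comp (continuous_const.mul ?_)
    exact Continuous.rpow_const (by fun_prop) fun _ => Or.inr (by linarith)
  have := hc.tendsto s
  simpa [Real.zero_rpow (show 2 * α + 1 ≠ 0 by linarith)] using this

end

/-! ### Local nondeterminism in `L²(ℝ)`. -/

/-- The primitive of `u ↦ u₊^α`. -/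
def rampPow (α u : ℝ) : ℝ := ∫ w in (0 : ℝ)..u, max w 0 ^ α

lemma continuous_max_rpow {α : ℝ} (hα : 0 < α) : Continuous fun w : ℝ => max w 0 ^ α :=
  Continuous.rpow_const (by fun_prop) fun _ => Or.inr hα.le

lemma rampPow_of_nonpos {α u : ℝ} (hα : 0 < α) (hu : u ≤ 0) : rampPow α u = 0 := by
  rw [rampPow, intervalIntegral.integral_congr (g := fun _ => (0 : ℝ)) fun w hw => ?_]
  · simp
  · rw [uIcc_of_ge hu] at hw
    simp [max_eq_right hw.2, Real.zero_rpow hα.ne']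

lemma rampPow_of_nonneg {α u : ℝ} (hα : 0 < α) (hu : 0 ≤ u) :
    rampPow α u = u ^ (α + 1) / (α + 1) := by
  rw [rampPow, intervalIntegral.integral_congr (g := fun w => w ^ α) fun w hw => ?_,
    integral_rpow (Or.inl (by linarith)), Real.zero_rpow (by linarith), sub_zero]
  rw [uIcc_of_le hu] at hw
  simp [max_eq_left hw.1]

lemma hasDerivAt_rampPow {α : ℝ} (hα : 0 < α) (u : ℝ) :
    HasDerivAt (rampPow α) (max u 0 ^ α) u :=
  ((continuous_max_rpow hα).integral_hasStrictDerivAt 0 u).hasDerivAt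

lemma continuous_rampPow {α : ℝ} (hα : 0 < α) : Continuous (rampPow α) :=
  continuous_iff_continuousAt.2 fun u => (hasDerivAt_rampPow hα u).continuousAt

/-- On `z ≥ 0` the term `(-z)₊^α` vanishes, and `(u - z)₊^α` vanishes beyond `u ≤ s`, so the end
point `s` plays no role. -/
lemma integral_fracKernel {α r s u : ℝ} (hα : 0 < α) (hr : 0 ≤ r) (hrs : r ≤ s) (hu : u ≤ s) :
    ∫ z in r..s, fracKernel α u z = rampPow α (u - r) := by
  have h1 : ∫ z in r..s, fracKernel α u z = ∫ z in r..s, max (u - z) 0 ^ α := by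
    refine intervalIntegral.integral_congr fun z hz => ?_
    rw [uIcc_of_le hrs] at hz
    simp only [fracKernel]
    rw [max_eq_right (a := -z) (by linarith [hz.1]), Real.zero_rpow hα.ne', sub_zero]
  have hi := fun a b => (continuous_max_rpow hα).intervalIntegrable (μ := volume) a b
  rw [h1, intervalIntegral.integral_comp_sub_left (fun x => max x 0 ^ α),
    ← intervalIntegral.integral_interval_sub_left (hi 0 _) (hi 0 _), ← rampPow, ← rampPow,
    rampPow_of_nonpos hα (u := u - s) (by linarith), sub_zero]

section

variable {α : ℝ} (hα : 0 < α) (hα1 : α < 1 / 2)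

/-- The element of `L²(ℝ)` that represents the solution `X_t`. -/
def solVec (a t : ℝ) : Lp ℝ 2 (volume : Measure ℝ) :=
  fracVec hα hα1 t + ∫ u in (0 : ℝ)..t, volterraKernel a t u • fracVec hα hα1 u

/-- The indicator of `(r, s]` in `L²(ℝ)`. -/
def iocVec (r s : ℝ) : Lp ℝ 2 (volume : Measure ℝ) :=
  indicatorConstLp 2 (measurableSet_Ioc (a := r) (b := s)) measure_Ioc_lt_top.ne 1

lemma norm_iocVec {r s : ℝ} (h : r ≤ s) : ‖iocVec r s‖ = (s - r) ^ (1 / 2 : ℝ) := by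
  rw [iocVec, norm_indicatorConstLp (by norm_num) (by norm_num)]
  simp [h]

lemma inner_iocVec_fracVec {r s u : ℝ} (hr : 0 ≤ r) (hrs : r ≤ s) (hu : u ≤ s) :
    inner ℝ (iocVec r s) (fracVec hα hα1 u) = rampPow α (u - r) := by
  rw [iocVec, L2.inner_indicatorConstLp_one, ← integral_fracKernel hα hr hrs hu,
    intervalIntegral.integral_of_le hrs]
  exact integral_congr_ae (ae_restrict_of_ae (MemLp.coeFn_toLp _))

/-- Integration by parts moves the derivative from the kernel `h`, whose derivative is
`-volterraKernel` and has no fixed sign, onto `rampPow`. The result has a nonnegative integrand when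
`0 < a`, and is zero for `t ≤ r`. -/
lemma inner_iocVec_solVec (a : ℝ) {r s t : ℝ} (hr : 0 ≤ r) (hrs : r ≤ s) (ht : 0 ≤ t)
    (hts : t ≤ s) :
    inner ℝ (iocVec r s) (solVec hα hα1 a t) =
      ∫ u in (0 : ℝ)..t, smoothKernel a t u * max (u - r) 0 ^ α := by
  have hk := continuous_volterraKernel a t
  have hf := continuous_fracVec hα hα1
  have hR : Continuous fun u => rampPow α (u - r) := (continuous_rampPow hα).comp (by fun_prop)
  have hS := continuous_smoothKernel a t
  have hM : Continuous fun u : ℝ => max (u - r) 0 ^ α :=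
    (continuous_max_rpow hα).comp (continuous_id.sub continuous_const)
  have h1 : inner ℝ (iocVec r s) (∫ u in (0 : ℝ)..t, volterraKernel a t u • fracVec hα hα1 u) =
      ∫ u in (0 : ℝ)..t, volterraKernel a t u * rampPow α (u - r) := by
    have h := (innerSL ℝ (iocVec r s)).intervalIntegral_comp_comm
      (show IntervalIntegrable (fun u => volterraKernel a t u • fracVec hα hα1 u) volume 0 t from
        (hk.smul hf).intervalIntegrable 0 t)
    rw [innerSL_apply_apply] at h
    rw [← h]
    refine intervalIntegral.integral_congr fun u hu => ?_
    rw [uIcc_of_le ht] at hu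
    simp only [innerSL_apply_apply]
    rw [real_inner_smul_right, inner_iocVec_fracVec hα hα1 hr hrs (hu.2.trans hts)]
  have h2 : ∫ u in (0 : ℝ)..t, (-volterraKernel a t u * rampPow α (u - r) +
      smoothKernel a t u * max (u - r) 0 ^ α) = rampPow α (t - r) := by
    rw [intervalIntegral.integral_eq_sub_of_hasDerivAt
      (f := fun u => smoothKernel a t u * rampPow α (u - r))]
    · simp [rampPow_of_nonpos hα (u := -r) (by linarith)]
    · intro u _
      exact (hasDerivAt_smoothKernel a t u).mul ((hasDerivAt_rampPow hα (u - r)).comp_sub_const u r)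
    · exact Continuous.intervalIntegrable (by fun_prop) _ _
  rw [intervalIntegral.integral_add (Continuous.intervalIntegrable (by fun_prop) _ _)
    (Continuous.intervalIntegrable (by fun_prop) _ _)] at h2
  simp only [neg_mul, intervalIntegral.integral_neg] at h2
  rw [solVec, inner_add_right, h1, inner_iocVec_fracVec hα hα1 hr hrs hts]
  linarith

/-- Local nondeterminism of the solution. -/
lemma le_norm_solVec_sub {a : ℝ} (ha : 0 < a) {T r s : ℝ} (hr : 0 ≤ r) (hrs : r < s) (hsT : s ≤ T)
    (c : ℝ) :
    Real.exp (-(a * T ^ 2 / 2)) / (α + 1) * (s - r) ^ (α + 1 / 2) ≤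
      ‖solVec hα hα1 a s - c • solVec hα hα1 a r‖ := by
  have hs : 0 ≤ s := hr.trans hrs.le
  have hd : 0 < s - r := by linarith
  have hM : Continuous fun u : ℝ => max (u - r) 0 ^ α :=
    (continuous_max_rpow hα).comp (continuous_id.sub continuous_const)
  have hS := continuous_smoothKernel a s
  -- The value at time `r` does not see the noise on `(r, s]`, so the bound is uniform in the
  -- coefficient `c`.
  have h0 : inner ℝ (iocVec r s) (solVec hα hα1 a r) = 0 := by
    rw [inner_iocVec_solVec hα hα1 a hr hrs.le hr hrs.le,
      intervalIntegral.integral_congr (g := fun _ => (0 : ℝ)) fun u hu => ?_]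
    · simp
    · rw [uIcc_of_le hr] at hu
      simp [max_eq_right (sub_nonpos.2 hu.2), Real.zero_rpow hα.ne']
  have h1 : Real.exp (-(a * T ^ 2 / 2)) * ((s - r) ^ (α + 1) / (α + 1)) ≤
      inner ℝ (iocVec r s) (solVec hα hα1 a s) := by
    rw [inner_iocVec_solVec hα hα1 a hr hrs.le hs le_rfl]
    have h2 : ∫ u in (0 : ℝ)..s, max (u - r) 0 ^ α = (s - r) ^ (α + 1) / (α + 1) := by
      rw [intervalIntegral.integral_eq_sub_of_hasDerivAt (f := fun u => rampPow α (u - r))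
        (fun u _ => (hasDerivAt_rampPow hα (u - r)).comp_sub_const u r)
        (hM.intervalIntegrable _ _), rampPow_of_nonpos hα (u := 0 - r) (by linarith), sub_zero,
        rampPow_of_nonneg hα hd.le]
    rw [← h2, ← intervalIntegral.integral_const_mul]
    refine intervalIntegral.integral_mono_on hs (Continuous.intervalIntegrable (by fun_prop) _ _)
      (Continuous.intervalIntegrable (by fun_prop) _ _) fun u hu => ?_
    refine mul_le_mul_of_nonneg_right ((Real.exp_le_exp.2 ?_).trans (exp_le_smoothKernel ha hu.2))
      (Real.rpow_nonneg (le_max_right _ _) _)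
    have : s ^ 2 ≤ T ^ 2 := pow_le_pow_left₀ hs hsT 2
    nlinarith
  -- Cauchy–Schwarz; the norm of the indicator is `(s - r)^(1/2)`, which lowers the exponent from `α
  -- + 1` to `α + 1/2 = H`.
  have h3 : inner ℝ (iocVec r s) (solVec hα hα1 a s) ≤
      (s - r) ^ (1 / 2 : ℝ) * ‖solVec hα hα1 a s - c • solVec hα hα1 a r‖ := by
    have h := real_inner_le_norm (iocVec r s) (solVec hα hα1 a s - c • solVec hα hα1 a r)
    rw [inner_sub_right, real_inner_smul_right, h0, mul_zero, sub_zero, norm_iocVec hrs.le] at h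
    exact h
  have h4 : (s - r) ^ (α + 1) = (s - r) ^ (1 / 2 : ℝ) * (s - r) ^ (α + 1 / 2) := by
    rw [← Real.rpow_add hd]
    congr 1
    ring
  have h5 : 0 < (s - r) ^ (1 / 2 : ℝ) := by positivity
  refine le_of_mul_le_mul_left (le_trans (le_of_eq ?_) (h1.trans h3)) h5
  rw [h4]
  ring

lemma fracConst_pos {α : ℝ} (hα : 0 < α) (hα1 : α < 1 / 2) : 0 < fracConst α := by
  have h := norm_fracVec_sq hα hα1 1
  rw [abs_one, Real.one_rpow, mul_one] at h
  rw [← h]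
  have h1 : inner ℝ (iocVec 0 1) (fracVec hα hα1 1) ≠ (0 : ℝ) := by
    rw [inner_iocVec_fracVec hα hα1 le_rfl zero_le_one le_rfl, sub_zero,
      rampPow_of_nonneg hα zero_le_one]
    simp
    linarith
  have : fracVec hα hα1 1 ≠ 0 := fun h => h1 (by simp [h])
  positivity

end

/-! ### Riemann sums. -/

/-- Left Riemann sums of a continuous function converge to its integral. -/
lemma tendsto_riemann_sum {G : Type*} [NormedAddCommGroup G] [NormedSpace ℝ G] [CompleteSpace G]
    {f : ℝ → G} {t : ℝ} (ht : 0 ≤ t) (hf : ContinuousOn f (Icc 0 t)) :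
    Tendsto (fun n : ℕ => ∑ i ∈ Finset.range n, (t / n) • f (t / n * i)) atTop
      (𝓝 (∫ u in (0 : ℝ)..t, f u)) := by
  rw [Metric.tendsto_atTop]
  intro ε hε
  have huc := isCompact_Icc.uniformContinuousOn_of_continuous hf
  rw [Metric.uniformContinuousOn_iff] at huc
  -- The denominator `t + 1` rather than `t` covers `t = 0` and makes the final estimate strict.
  obtain ⟨δ, hδ, hfδ⟩ := huc (ε / (t + 1)) (by positivity)
  obtain ⟨N, hN⟩ := exists_nat_gt (t / δ)
  refine ⟨N + 1, fun n hn => ?_⟩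
  have hn0 : (0 : ℝ) < n := by
    have : 0 < n := by omega
    exact_mod_cast this
  have hnN : t / δ < n := hN.trans_le (by exact_mod_cast (by omega : N ≤ n))
  have hd : 0 ≤ t / n := by positivity
  have hstep : t / n < δ := by
    rw [div_lt_iff₀ hδ] at hnN
    rw [div_lt_iff₀ hn0]
    linarith
  have hmem : ∀ i < n, ∀ u ∈ Icc (t / n * i) (t / n * (i + 1)), u ∈ Icc 0 t := by
    intro i hi u hu
    refine ⟨le_trans (by positivity) hu.1, hu.2.trans ?_⟩
    have : (i : ℝ) + 1 ≤ n := by exact_mod_cast hi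
    calc t / n * (i + 1) ≤ t / n * n := by gcongr
      _ = t := by field_simp
  have hle : ∀ i : ℕ, t / n * i ≤ t / n * (i + 1) := fun i => by nlinarith
  have hint : ∀ i < n, IntervalIntegrable f volume (t / n * i) (t / n * (i + 1 : ℕ)) := by
    intro i hi
    refine (hf.mono fun u hu => ?_).intervalIntegrable
    push_cast at hu
    rw [uIcc_of_le (hle i)] at hu
    exact hmem i hi u hu
  have hsum := intervalIntegral.sum_integral_adjacent_intervals (a := fun i : ℕ => t / n * i) hint
  have hend : t / n * (n : ℝ) = t := by field_simp
  simp only [Nat.cast_zero, mul_zero, hend] at hsum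
  rw [dist_comm, dist_eq_norm, ← hsum, ← Finset.sum_sub_distrib]
  have hterm : ∀ i ∈ Finset.range n, ‖(∫ u in (t / n * i)..(t / n * (i + 1 : ℕ)), f u) -
      (t / n) • f (t / n * i)‖ ≤ ε / (t + 1) * (t / n) := by
    intro i hi
    have hi' := Finset.mem_range.1 hi
    have h1 : (t / n) • f (t / n * i) =
        ∫ u in (t / n * i)..(t / n * (i + 1 : ℕ)), f (t / n * i) := by
      rw [intervalIntegral.integral_const]
      congr 1
      push_cast
      ring
    rw [h1, ← intervalIntegral.integral_sub (hint i hi') (by simp)]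
    refine (intervalIntegral.norm_integral_le_of_norm_le_const (C := ε / (t + 1))
      fun u hu => ?_).trans (le_of_eq ?_)
    · push_cast at hu
      rw [uIoc_of_le (hle i)] at hu
      rw [← dist_eq_norm]
      refine (hfδ u (hmem i hi' u ⟨hu.1.le, hu.2⟩) _
        (hmem i hi' _ ⟨le_rfl, hle i⟩) ?_).le
      rw [Real.dist_eq, abs_of_pos (by linarith [hu.1])]
      nlinarith [hu.2]
    · push_cast
      rw [show t / n * (i + 1) - t / n * i = t / n by ring, abs_of_nonneg hd]
  refine (norm_sum_le_of_le _ hterm).trans_lt ?_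
  rw [Finset.sum_const, Finset.card_range, nsmul_eq_mul]
  calc (n : ℝ) * (ε / (t + 1) * (t / n)) = ε * (t / (t + 1)) := by field_simp
    _ < ε * 1 := by
        gcongr
        rw [div_lt_one (by positivity)]
        linarith
    _ = ε := mul_one ε

/-! ### Gaussian laws of Volterra transforms and regression. -/

section

variable {Ω : Type*} {E : Type*} [NormedAddCommGroup E]
  [InnerProductSpace ℝ E]

/-- The graph of the isometry from the linear span of `B` to the linear span of `κ`. -/
def gaussSpan (B : ℝ → Ω → ℝ) (κ : ℝ → E) : Submodule ℝ ((Ω → ℝ) × E) :=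
  Submodule.span ℝ (range fun t : ℝ≥0 => (B t, κ t))

lemma mem_gaussSpan (B : ℝ → Ω → ℝ) (κ : ℝ → E) {t : ℝ} (ht : 0 ≤ t) :
    (B t, κ t) ∈ gaussSpan B κ :=
  Submodule.subset_span ⟨⟨t, ht⟩, rfl⟩

/-- The Riemann approximation of the Volterra transform of `p`. -/
def volterraSum {V : Type*} [AddCommGroup V] [Module ℝ V] (a : ℝ) (p : ℝ → V) (t : ℝ) (n : ℕ) : V :=
  p t + ∑ i ∈ Finset.range n, (t / n) • volterraKernel a t (t / n * i) • p (t / n * i)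

lemma tendsto_volterraSum {G : Type*} [NormedAddCommGroup G] [NormedSpace ℝ G] [CompleteSpace G]
    (a : ℝ) {p : ℝ → G} {t : ℝ} (ht : 0 ≤ t) (hp : ContinuousOn p (Icc 0 t)) :
    Tendsto (volterraSum a p t) atTop
      (𝓝 (p t + ∫ u in (0 : ℝ)..t, volterraKernel a t u • p u)) :=
  tendsto_const_nhds.add (tendsto_riemann_sum ht
    ((continuous_volterraKernel a t).continuousOn.smul hp))

lemma volterraSum_mem_gaussSpan (a : ℝ) (B : ℝ → Ω → ℝ) (κ : ℝ → E) {t : ℝ} (ht : 0 ≤ t) (n : ℕ) :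
    volterraSum a (fun t => (B t, κ t)) t n ∈ gaussSpan B κ := by
  refine add_mem (mem_gaussSpan B κ ht) (sum_mem fun i _ => ?_)
  exact Submodule.smul_mem _ _ (Submodule.smul_mem _ _ (mem_gaussSpan B κ (by positivity)))

lemma volterraSum_prod (a : ℝ) (B : ℝ → Ω → ℝ) (κ : ℝ → E) (t : ℝ) (n : ℕ) :
    volterraSum a (fun t => (B t, κ t)) t n =
      (fun ω => volterraSum a (fun t => B t ω) t n, volterraSum a κ t n) := by
  refine Prod.ext ?_ ?_
  · ext ω
    simp [volterraSum, Prod.fst_sum, Finset.sum_apply]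
  · simp [volterraSum, Prod.snd_sum]

variable [MeasurableSpace Ω] {μ : Measure Ω}

/-- Carrying the pair `(Y, k)` in one span lets the same linear combination be read on both sides,
without constructing the isometry. First components are genuine functions of `ω`, so pathwise limits
can be taken later. The constant `c` accounts for the kernel not being normalized. -/
lemma map_eq_gaussianReal_of_mem_gaussSpan [IsProbabilityMeasure μ] {B : ℝ → Ω → ℝ} {κ : ℝ → E}
    {c : ℝ} (hB : IsGaussianProcess (fun t : ℝ≥0 => B (t : ℝ)) μ)
    (h0 : ∀ t : ℝ, 0 ≤ t → ∫ ω, B t ω ∂μ = 0)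
    (hcov : ∀ t s : ℝ, 0 ≤ t → 0 ≤ s → ∫ ω, B t ω * B s ω ∂μ = inner ℝ (κ t) (κ s) / c)
    {Y : Ω → ℝ} {k : E} (hY : (Y, k) ∈ gaussSpan B κ) :
    AEMeasurable Y μ ∧ μ.map Y = gaussianReal 0 (‖k‖ ^ 2 / c).toNNReal := by
  obtain ⟨l, hl⟩ := Finsupp.mem_span_range_iff_exists_finsupp.1 hY
  have hL2 : ∀ t : ℝ≥0, MemLp (B t) 2 μ := fun t => (hB.hasGaussianLaw_eval t).memLp_two
  have hYl : Y = fun ω => ∑ t ∈ l.support, l t * B t ω := by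
    have := congrArg Prod.fst hl
    simp only [Finsupp.sum, Prod.fst_sum, Prod.smul_mk] at this
    rw [← this]
    ext ω
    simp [Finset.sum_apply]
  have hkl : k = ∑ t ∈ l.support, l t • κ t := by
    have := congrArg Prod.snd hl
    simp only [Finsupp.sum, Prod.snd_sum, Prod.smul_mk] at this
    exact this.symm
  have hG : HasGaussianLaw Y μ := by
    have := (hB.smul (fun t => l t)).hasGaussianLaw_fun_sum (I := l.support)
    simpa [hYl] using this
  have hmean : ∫ ω, Y ω ∂μ = 0 := by
    rw [hYl, integral_finsetSum _ fun t _ => ((hL2 t).integrable (by norm_num)).const_mul _]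
    refine Finset.sum_eq_zero fun t _ => ?_
    rw [integral_const_mul, h0 t t.2, mul_zero]
  have hsq : ∫ ω, Y ω ^ 2 ∂μ = ‖k‖ ^ 2 / c := by
    have e : ∀ ω, Y ω ^ 2 =
        ∑ t ∈ l.support, ∑ s ∈ l.support, l t * l s * (B t ω * B s ω) := fun ω => by
      rw [hYl, sq, Finset.sum_mul_sum]
      refine Finset.sum_congr rfl fun t _ => Finset.sum_congr rfl fun s _ => by ring
    have hi : ∀ t s : ℝ≥0, Integrable (fun ω => l t * l s * (B t ω * B s ω)) μ := fun t s =>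
      ((hL2 t).integrable_mul (hL2 s)).const_mul _
    simp only [e]
    rw [integral_finsetSum _ fun t _ => integrable_finsetSum _ fun s _ => hi t s,
      ← real_inner_self_eq_norm_sq, hkl, sum_inner, Finset.sum_div]
    refine Finset.sum_congr rfl fun t _ => ?_
    rw [integral_finsetSum _ fun s _ => hi t s, inner_sum, Finset.sum_div]
    refine Finset.sum_congr rfl fun s _ => ?_
    rw [integral_const_mul, hcov t s t.2 s.2, real_inner_smul_left, real_inner_smul_right]
    ring
  refine ⟨hG.aemeasurable, ?_⟩
  rw [hG.map_eq_gaussianReal, hmean, variance_eq_sub hG.memLp_two, hmean]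
  congr 2
  simpa using hsq

lemma charFun_gaussianReal_div {F : Type*} [NormedAddCommGroup F] {c : ℝ} (hc : 0 < c) (v : F)
    (ξ : ℝ) : charFun (gaussianReal 0 (‖v‖ ^ 2 / c).toNNReal) ξ =
      Complex.exp (-((‖v‖ ^ 2 / c : ℝ) * ξ ^ 2 / 2)) := by
  rw [charFun_gaussianReal]
  congr 1
  simp only [Complex.ofReal_zero, mul_zero, zero_mul, zero_sub]
  have : (((‖v‖ ^ 2 / c).toNNReal : ℝ≥0) : ℂ) = ((‖v‖ ^ 2 / c : ℝ) : ℂ) := by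
    have h : ((‖v‖ ^ 2 / c).toNNReal : ℝ) = ‖v‖ ^ 2 / c := Real.coe_toNNReal _ (by positivity)
    exact congrArg Complex.ofReal h
  rw [this]

/-- Characteristic functions converge on one side by dominated convergence, on the other because the
variances do. -/
lemma map_eq_gaussianReal_of_tendsto [IsProbabilityMeasure μ] {F : Type*} [NormedAddCommGroup F]
    {c : ℝ}
    {Y : ℕ → Ω → ℝ} {k : ℕ → F} {Z : Ω → ℝ} {z : F} (hc : 0 < c)
    (hY : ∀ n, AEMeasurable (Y n) μ)
    (hlaw : ∀ n, μ.map (Y n) = gaussianReal 0 (‖k n‖ ^ 2 / c).toNNReal)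
    (hZ : AEMeasurable Z μ) (hYZ : ∀ᵐ ω ∂μ, Tendsto (fun n => Y n ω) atTop (𝓝 (Z ω)))
    (hk : Tendsto k atTop (𝓝 z)) :
    μ.map Z = gaussianReal 0 (‖z‖ ^ 2 / c).toNNReal := by
  have : IsProbabilityMeasure (μ.map Z) := Measure.isProbabilityMeasure_map hZ
  refine Measure.ext_of_charFun ?_
  ext ξ
  have key : ∀ {W : Ω → ℝ}, AEMeasurable W μ →
      charFun (μ.map W) ξ = ∫ ω, Complex.exp (ξ * W ω * Complex.I) ∂μ := fun {W} hW => by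
    rw [charFun_apply_real, integral_map hW]
    exact Continuous.aestronglyMeasurable (by fun_prop)
  have h1 : Tendsto (fun n => ∫ ω, Complex.exp (ξ * Y n ω * Complex.I) ∂μ) atTop
      (𝓝 (∫ ω, Complex.exp (ξ * Z ω * Complex.I) ∂μ)) := by
    refine tendsto_integral_of_dominated_convergence (fun _ => 1) (fun n => ?_)
      (integrable_const _) (fun n => ?_) ?_
    · have h : Continuous fun y : ℝ => Complex.exp (ξ * y * Complex.I) := by fun_prop
      exact h.aestronglyMeasurable.comp_aemeasurable (hY n)
    · refine Eventually.of_forall fun ω => ?_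
      rw [← Complex.ofReal_mul, Complex.norm_exp_ofReal_mul_I]
    · filter_upwards [hYZ] with ω hω
      have h : Continuous fun y : ℝ => Complex.exp (ξ * y * Complex.I) := by fun_prop
      exact (h.tendsto _).comp hω
  have h2 : Tendsto (fun n => charFun (gaussianReal 0 (‖k n‖ ^ 2 / c).toNNReal) ξ) atTop
      (𝓝 (charFun (gaussianReal 0 (‖z‖ ^ 2 / c).toNNReal) ξ)) := by
    simp only [charFun_gaussianReal_div hc]
    have h : Continuous fun v : F => Complex.exp (-((‖v‖ ^ 2 / c : ℝ) * ξ ^ 2 / 2)) := by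
      fun_prop
    exact (h.tendsto _).comp hk
  refine tendsto_nhds_unique ?_ h2
  rw [key hZ]
  refine h1.congr fun n => ?_
  rw [← key (hY n), hlaw n]

/-- The joint law of two values of a Volterra transform of a Gaussian process. -/
lemma map_volterra_combination [IsProbabilityMeasure μ] [CompleteSpace E] {B X : ℝ → Ω → ℝ}
    {κ : ℝ → E} {c a : ℝ} (hc : 0 < c) (hB : IsGaussianProcess (fun t : ℝ≥0 => B (t : ℝ)) μ)
    (h0 : ∀ t : ℝ, 0 ≤ t → ∫ ω, B t ω ∂μ = 0)
    (hcov : ∀ t s : ℝ, 0 ≤ t → 0 ≤ s → ∫ ω, B t ω * B s ω ∂μ = inner ℝ (κ t) (κ s) / c)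
    (hBc : ∀ᵐ ω ∂μ, ContinuousOn (fun t => B t ω) (Ici 0)) (hκ : Continuous κ)
    {r s : ℝ} (hr : 0 ≤ r) (hs : 0 ≤ s) (hXr : AEMeasurable (X r) μ) (hXs : AEMeasurable (X s) μ)
    (hr' : ∀ᵐ ω ∂μ, X r ω = B r ω + ∫ u in (0 : ℝ)..r, volterraKernel a r u * B u ω)
    (hs' : ∀ᵐ ω ∂μ, X s ω = B s ω + ∫ u in (0 : ℝ)..s, volterraKernel a s u * B u ω)
    (x y : ℝ) :
    μ.map (fun ω => x * X r ω + y * X s ω) = gaussianReal 0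
      (‖x • (κ r + ∫ u in (0 : ℝ)..r, volterraKernel a r u • κ u) +
        y • (κ s + ∫ u in (0 : ℝ)..s, volterraKernel a s u • κ u)‖ ^ 2 / c).toNNReal := by
  have hmem : ∀ n, x • volterraSum a (fun t => (B t, κ t)) r n +
      y • volterraSum a (fun t => (B t, κ t)) s n ∈ gaussSpan B κ := fun n =>
    add_mem (Submodule.smul_mem _ _ (volterraSum_mem_gaussSpan a B κ hr n))
      (Submodule.smul_mem _ _ (volterraSum_mem_gaussSpan a B κ hs n))
  simp only [volterraSum_prod, Prod.smul_mk, Prod.mk_add_mk] at hmem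
  have hlaw := fun n => map_eq_gaussianReal_of_mem_gaussSpan hB h0 hcov (hmem n)
  refine map_eq_gaussianReal_of_tendsto hc (fun n => (hlaw n).1) (fun n => (hlaw n).2)
    ((hXr.const_mul x).add (hXs.const_mul y)) ?_ ?_
  · filter_upwards [hBc, hr', hs'] with ω hω hrω hsω
    have h1 := tendsto_volterraSum a hr (hω.mono Icc_subset_Ici_self)
    have h2 := tendsto_volterraSum a hs (hω.mono Icc_subset_Ici_self)
    simp only [smul_eq_mul, ← hrω] at h1
    simp only [smul_eq_mul, ← hsω] at h2
    exact (h1.const_mul x).add (h2.const_mul y)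
  · exact ((tendsto_volterraSum a hr hκ.continuousOn).const_smul x).add
      ((tendsto_volterraSum a hs hκ.continuousOn).const_smul y)

/-- Orthogonality of `k` and `l` removes the cross term in the exponent, so the joint characteristic
function factorizes. -/
lemma map_prod_eq_of_combination [IsProbabilityMeasure μ] {U V : Ω → ℝ} {k l : E} {c : ℝ}
    (hc : 0 < c) (hU : AEMeasurable U μ) (hV : AEMeasurable V μ) (hkl : inner ℝ k l = (0 : ℝ))
    (h : ∀ x y : ℝ, μ.map (fun ω => x * U ω + y * V ω) =
      gaussianReal 0 (‖x • k + y • l‖ ^ 2 / c).toNNReal) :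
    μ.map (fun ω => (U ω, V ω)) =
      (gaussianReal 0 (‖k‖ ^ 2 / c).toNNReal).prod (gaussianReal 0 (‖l‖ ^ 2 / c).toNNReal) := by
  have hUV : AEMeasurable (fun ω => (U ω, V ω)) μ := hU.prodMk hV
  have : IsProbabilityMeasure (μ.map fun ω => (U ω, V ω)) := Measure.isProbabilityMeasure_map hUV
  rw [← charFunDual_eq_prod_iff]
  intro L
  have hL : ∀ p : ℝ × ℝ, L p = L (1, 0) * p.1 + L (0, 1) * p.2 := fun p => by
    have : p = p.1 • ((1 : ℝ), (0 : ℝ)) + p.2 • ((0 : ℝ), (1 : ℝ)) := by ext <;> simp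
    conv_lhs => rw [this, map_add, map_smul, map_smul]
    simp [mul_comm]
  have h1 : ∀ (x : ℝ) (v : ℝ≥0) (M : StrongDual ℝ ℝ), (∀ y, M y = x * y) →
      charFunDual (gaussianReal 0 v) M = charFun (gaussianReal 0 v) x := by
    intro x v M hM
    rw [charFunDual_apply, charFun_apply_real]
    simp only [hM, Complex.ofReal_mul]
  rw [h1 (L (1, 0)) _ _ (fun y => by simp [hL (y, 0)]),
    h1 (L (0, 1)) _ _ (fun y => by simp [hL (0, y)]), charFun_gaussianReal_div hc,
    charFun_gaussianReal_div hc, charFunDual_eq_charFun_map_one,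
    AEMeasurable.map_map_of_aemeasurable L.continuous.aemeasurable hUV]
  have h2 : (L ∘ fun ω => (U ω, V ω)) = fun ω => L (1, 0) * U ω + L (0, 1) * V ω := by
    ext ω
    simp [hL (U ω, V ω)]
  rw [h2, h, charFun_gaussianReal_div hc, ← Complex.exp_add, norm_add_sq_real,
    real_inner_smul_left, real_inner_smul_right, hkl, norm_smul, norm_smul]
  congr 1
  simp only [mul_pow, Real.norm_eq_abs, sq_abs]
  push_cast
  ring

/-- Regression of `V` on `U` for a centered Gaussian pair. -/
lemma map_regression [IsProbabilityMeasure μ] {U V : Ω → ℝ} {k l : E} {c : ℝ}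
    (hc : 0 < c) (hk : k ≠ 0) (hU : AEMeasurable U μ) (hV : AEMeasurable V μ)
    (h : ∀ x y : ℝ, μ.map (fun ω => x * U ω + y * V ω) =
      gaussianReal 0 (‖x • k + y • l‖ ^ 2 / c).toNNReal) :
    ∃ ρ : ℝ, μ.map (fun ω => (U ω, V ω - ρ * U ω)) =
      (gaussianReal 0 (‖k‖ ^ 2 / c).toNNReal).prod
        (gaussianReal 0 (‖l - ρ • k‖ ^ 2 / c).toNNReal) := by
  -- The coefficient of the orthogonal projection of `l` on `k`.
  refine ⟨inner ℝ k l / ‖k‖ ^ 2, map_prod_eq_of_combination hc hU (hV.sub (hU.const_mul _)) ?_ ?_⟩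
  · rw [inner_sub_right, real_inner_smul_right, real_inner_self_eq_norm_sq]
    have : ‖k‖ ≠ 0 := norm_ne_zero_iff.2 hk
    field_simp
    ring
  · intro x y
    have := h (x - y * (inner ℝ k l / ‖k‖ ^ 2)) y
    convert this using 2
    · ext ω
      ring
    · congr 4
      module

end

/-! ### Gaussian densities and window averages. -/

lemma gaussianPDFReal_zero_mean (v : ℝ≥0) (z : ℝ) :
    gaussianPDFReal 0 v z = (√(2 * Real.pi * v))⁻¹ * Real.exp (-(z / √v) ^ 2 / 2) := by
  rw [gaussianPDFReal, sub_zero, div_pow, Real.sq_sqrt (NNReal.coe_nonneg v)]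
  congr 2
  rw [neg_div, neg_div, div_div, mul_comm (v : ℝ) 2]

lemma inv_sqrt_two_pi_mul_le (v : ℝ≥0) : (√(2 * Real.pi * v))⁻¹ ≤ (√v)⁻¹ := by
  rcases eq_or_ne v 0 with rfl | hv
  · simp
  · have hv' : (0 : ℝ) < v := by positivity
    have hpi := Real.pi_gt_three
    gcongr
    nlinarith

lemma gaussianPDFReal_zero_mean_le (v : ℝ≥0) (z : ℝ) : gaussianPDFReal 0 v z ≤ (√v)⁻¹ := by
  rw [gaussianPDFReal_zero_mean]
  refine (mul_le_of_le_one_right (by positivity) (Real.exp_le_one_iff.2 ?_)).trans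
    (inv_sqrt_two_pi_mul_le v)
  have := sq_nonneg (z / √v)
  linarith

lemma abs_exp_neg_sq_sub_le (p q : ℝ) :
    |Real.exp (-p ^ 2 / 2) - Real.exp (-q ^ 2 / 2)| ≤ |p - q| := by
  have hd : ∀ x : ℝ, HasDerivAt (fun x => Real.exp (-x ^ 2 / 2)) (-x * Real.exp (-x ^ 2 / 2)) x := by
    intro x
    have h : HasDerivAt (fun x : ℝ => -x ^ 2 / 2) (-x) x := by
      refine (((hasDerivAt_pow 2 x).neg).div_const 2).congr_deriv ?_
      push_cast
      ring
    exact h.exp.congr_deriv (by ring)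
  have hb : ∀ x : ℝ, ‖-x * Real.exp (-x ^ 2 / 2)‖ ≤ 1 := by
    intro x
    rw [norm_mul, norm_neg, Real.norm_eq_abs, Real.norm_eq_abs, Real.abs_exp, neg_div,
      Real.exp_neg, ← div_eq_mul_inv, div_le_one (Real.exp_pos _)]
    have h1 := Real.add_one_le_exp (x ^ 2 / 2)
    have h2 : |x| ^ 2 = x ^ 2 := sq_abs x
    nlinarith [sq_nonneg (|x| - 1)]
  have := convex_univ.norm_image_sub_le_of_norm_hasDerivWithin_le (x := q) (y := p)
    (fun x _ => (hd x).hasDerivWithinAt) (fun x _ => hb x) (mem_univ _) (mem_univ _)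
  simpa using this

/-- Interpolation between the trivial bound and the Lipschitz bound. The exponent `θ` stays free
because each power of `1/√v` is a singularity that must remain integrable in time. -/
lemma abs_gaussianPDFReal_sub_le {v : ℝ≥0} (hv : v ≠ 0) {θ : ℝ} (hθ0 : 0 ≤ θ) (hθ1 : θ ≤ 1)
    (x y : ℝ) :
    |gaussianPDFReal 0 v x - gaussianPDFReal 0 v y| ≤ (√v)⁻¹ * (|x - y| / √v) ^ θ := by
  have hv' : 0 < √(v : ℝ) := by positivity
  rw [gaussianPDFReal_zero_mean, gaussianPDFReal_zero_mean, ← mul_sub, abs_mul,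
    abs_of_nonneg (a := (√(2 * Real.pi * v))⁻¹) (by positivity)]
  refine mul_le_mul (inv_sqrt_two_pi_mul_le v) ?_ (abs_nonneg _) (by positivity)
  set d := |Real.exp (-(x / √v) ^ 2 / 2) - Real.exp (-(y / √v) ^ 2 / 2)| with hd
  have h1 : d ≤ |x - y| / √v := by
    refine (abs_exp_neg_sq_sub_le _ _).trans (le_of_eq ?_)
    rw [← sub_div, abs_div, abs_of_pos hv']
  have h2 : d ≤ 1 := by
    have e : ∀ p : ℝ, Real.exp (-p ^ 2 / 2) ≤ 1 := fun p => by
      rw [Real.exp_le_one_iff]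
      have := sq_nonneg p
      linarith
    rw [hd, abs_le]
    have p1 := Real.exp_pos (-(x / √v) ^ 2 / 2)
    have p2 := Real.exp_pos (-(y / √v) ^ 2 / 2)
    constructor <;> linarith [e (x / √v), e (y / √v)]
  calc d = d ^ (1 : ℝ) := (Real.rpow_one d).symm
    _ ≤ d ^ θ := Real.rpow_le_rpow_of_exponent_ge' (abs_nonneg _) h2 hθ0 hθ1
    _ ≤ _ := Real.rpow_le_rpow (abs_nonneg _) h1 hθ0

/-- The normalized indicator of `[x - ε, x + ε]`. -/
def window (x ε y : ℝ) : ℝ := 1 / (2 * ε) * (Icc (x - ε) (x + ε)).indicator (fun _ => (1 : ℝ)) y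

lemma measurable_window (x ε : ℝ) : Measurable (window x ε) :=
  (measurable_const.indicator measurableSet_Icc).const_mul _

lemma window_nonneg {ε : ℝ} (hε : 0 < ε) (x y : ℝ) : 0 ≤ window x ε y :=
  mul_nonneg (by positivity) (indicator_nonneg (fun _ _ => zero_le_one) _)

lemma window_le {ε : ℝ} (hε : 0 < ε) (x y : ℝ) : window x ε y ≤ 1 / (2 * ε) :=
  mul_le_of_le_one_right (by positivity) (indicator_le_self' (fun _ _ => zero_le_one) _)

lemma abs_window_le {ε : ℝ} (hε : 0 < ε) (x y : ℝ) : |window x ε y| ≤ 1 / (2 * ε) := by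
  rw [abs_of_nonneg (window_nonneg hε x y)]
  exact window_le hε x y

lemma integrable_window {ε : ℝ} (hε : 0 < ε) (x c : ℝ) (ν : Measure ℝ) [IsFiniteMeasure ν] :
    Integrable (fun w => window x ε (w + c)) ν :=
  Integrable.of_bound ((measurable_window x ε).comp (measurable_add_const c)).aestronglyMeasurable
    (1 / (2 * ε)) (Eventually.of_forall fun _ => abs_window_le hε _ _)

lemma integral_window_gaussianReal {ε : ℝ} (hε : 0 < ε) (x c : ℝ) {v : ℝ≥0} (hv : v ≠ 0) :
    ∫ w, window x ε (w + c) ∂gaussianReal 0 v =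
      1 / (2 * ε) * ∫ w in (x - c - ε)..(x - c + ε), gaussianPDFReal 0 v w := by
  rw [integral_gaussianReal_eq_integral_smul hv, intervalIntegral.integral_of_le (by linarith),
    ← integral_Icc_eq_integral_Ioc, ← integral_indicator measurableSet_Icc, ← integral_const_mul]
  congr 1
  ext w
  have h : w + c ∈ Icc (x - ε) (x + ε) ↔ w ∈ Icc (x - c - ε) (x - c + ε) := by
    simp only [mem_Icc]
    constructor <;> rintro ⟨h1, h2⟩ <;> constructor <;> linarith
  by_cases hw : w ∈ Icc (x - c - ε) (x - c + ε)
  · rw [window, indicator_of_mem (h.2 hw), indicator_of_mem hw, smul_eq_mul]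
    ring
  · rw [window, indicator_of_notMem (fun h' => hw (h.1 h')), indicator_of_notMem hw]
    simp

lemma continuous_gaussianPDFReal (v : ℝ≥0) : Continuous (gaussianPDFReal 0 v) := by
  unfold gaussianPDFReal
  fun_prop

lemma integral_window_gaussianReal_le {ε : ℝ} (hε : 0 < ε) (x c : ℝ) {v : ℝ≥0} (hv : v ≠ 0) :
    ∫ w, window x ε (w + c) ∂gaussianReal 0 v ≤ (√v)⁻¹ := by
  rw [integral_window_gaussianReal hε x c hv]
  have h : ∫ w in (x - c - ε)..(x - c + ε), gaussianPDFReal 0 v w ≤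
      ∫ w in (x - c - ε)..(x - c + ε), (√v)⁻¹ :=
    intervalIntegral.integral_mono_on (by linarith)
      ((continuous_gaussianPDFReal v).intervalIntegrable _ _) (by simp)
      fun w _ => gaussianPDFReal_zero_mean_le v w
  rw [intervalIntegral.integral_const, smul_eq_mul,
    show x - c + ε - (x - c - ε) = 2 * ε by ring] at h
  rw [one_div_mul_eq_div, div_le_iff₀ (by positivity)]
  linarith

/-- Comparison with the value of the density at the centre. The common scale `m` lets two windows of
different widths be compared. -/
lemma abs_integral_window_sub_le {ε m : ℝ} (hε : 0 < ε) (hm : ε ≤ m) (x c : ℝ) {v : ℝ≥0}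
    (hv : v ≠ 0) {θ : ℝ} (hθ0 : 0 ≤ θ) (hθ1 : θ ≤ 1) :
    |(∫ w, window x ε (w + c) ∂gaussianReal 0 v) - gaussianPDFReal 0 v (x - c)| ≤
      (√v)⁻¹ * (m / √v) ^ θ := by
  have hi := (continuous_gaussianPDFReal v).intervalIntegrable (μ := volume) (x - c - ε) (x - c + ε)
  have h1 : (∫ w, window x ε (w + c) ∂gaussianReal 0 v) - gaussianPDFReal 0 v (x - c) =
      1 / (2 * ε) * ∫ w in (x - c - ε)..(x - c + ε),
        (gaussianPDFReal 0 v w - gaussianPDFReal 0 v (x - c)) := by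
    rw [integral_window_gaussianReal hε x c hv, intervalIntegral.integral_sub hi (by simp),
      intervalIntegral.integral_const, smul_eq_mul]
    field_simp
    ring
  have h2 : |∫ w in (x - c - ε)..(x - c + ε),
      (gaussianPDFReal 0 v w - gaussianPDFReal 0 v (x - c))| ≤
      (√v)⁻¹ * (m / √v) ^ θ * |x - c + ε - (x - c - ε)| := by
    rw [← Real.norm_eq_abs]
    refine intervalIntegral.norm_integral_le_of_norm_le_const fun w hw => ?_
    rw [uIoc_of_le (by linarith)] at hw
    refine (abs_gaussianPDFReal_sub_le hv hθ0 hθ1 w (x - c)).trans ?_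
    have h3 : |w - (x - c)| ≤ m := by
      rw [abs_le]
      constructor <;> linarith [hw.1, hw.2]
    gcongr
  rw [show x - c + ε - (x - c - ε) = 2 * ε by ring, abs_of_pos (a := 2 * ε) (by positivity)] at h2
  rw [h1, abs_mul, abs_of_pos (a := 1 / (2 * ε)) (by positivity), one_div_mul_eq_div,
    div_le_iff₀ (by positivity)]
  exact h2

/-! ### Two-point estimates from regression. -/

section

variable {Ω : Type*} [MeasurableSpace Ω] {μ : Measure Ω}

/-- Given `U`, the variable `S` is an independent Gaussian shifted by `ρ U`. A bound on `g` uniform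
over all shifts therefore decouples the two factors, whatever `ρ` is. -/
lemma abs_integral_mul_le_of_regression {U S : Ω → ℝ} {V v : ℝ≥0} {ρ : ℝ} (hU : AEMeasurable U μ)
    (hS : AEMeasurable S μ)
    (hlaw : μ.map (fun ω => (U ω, S ω - ρ * U ω)) = (gaussianReal 0 V).prod (gaussianReal 0 v))
    {f g : ℝ → ℝ} (hf : Measurable f) (hg : Measurable g) {Cf Cg M N : ℝ} (hfb : ∀ y, |f y| ≤ Cf)
    (hgb : ∀ y, |g y| ≤ Cg) (hgM : ∀ c, |∫ w, g (w + c) ∂gaussianReal 0 v| ≤ M)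
    (hfN : ∫ u, |f u| ∂gaussianReal 0 V ≤ N) :
    |∫ ω, f (U ω) * g (S ω) ∂μ| ≤ N * M := by
  have hM : 0 ≤ M := (abs_nonneg _).trans (hgM 0)
  have hCf : 0 ≤ Cf := (abs_nonneg _).trans (hfb 0)
  have hm : Measurable fun p : ℝ × ℝ => f p.1 * g (p.2 + ρ * p.1) :=
    (hf.comp measurable_fst).mul (hg.comp (measurable_snd.add (measurable_fst.const_mul ρ)))
  have h1 : ∫ ω, f (U ω) * g (S ω) ∂μ =
      ∫ p, f p.1 * g (p.2 + ρ * p.1) ∂(gaussianReal 0 V).prod (gaussianReal 0 v) := by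
    have hUS : AEMeasurable (fun ω => (U ω, S ω - ρ * U ω)) μ :=
      hU.prodMk (hS.sub (hU.const_mul ρ))
    rw [← hlaw, integral_map hUS hm.aestronglyMeasurable]
    simp
  have hint : Integrable (fun p : ℝ × ℝ => f p.1 * g (p.2 + ρ * p.1))
      ((gaussianReal 0 V).prod (gaussianReal 0 v)) := by
    refine Integrable.of_bound hm.aestronglyMeasurable (Cf * Cg) (Eventually.of_forall fun p => ?_)
    rw [norm_mul]
    exact mul_le_mul (hfb _) (hgb _) (norm_nonneg _) hCf
  have hfi : Integrable f (gaussianReal 0 V) :=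
    Integrable.of_bound hf.aestronglyMeasurable Cf (Eventually.of_forall hfb)
  rw [h1, integral_prod _ hint]
  simp only [integral_const_mul]
  calc |∫ u, f u * ∫ w, g (w + ρ * u) ∂gaussianReal 0 v ∂gaussianReal 0 V|
      ≤ ∫ u, |f u| * M ∂gaussianReal 0 V := by
        rw [← Real.norm_eq_abs]
        refine norm_integral_le_of_norm_le (hfi.abs.mul_const M) (Eventually.of_forall fun u => ?_)
        rw [norm_mul]
        exact mul_le_mul_of_nonneg_left (hgM _) (norm_nonneg _)
    _ = (∫ u, |f u| ∂gaussianReal 0 V) * M := integral_mul_const _ _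
    _ ≤ N * M := mul_le_mul_of_nonneg_right hfN hM

lemma integral_window_mul_window_le {U S : Ω → ℝ} {V v : ℝ≥0} {ρ : ℝ} (hV : V ≠ 0) (hv : v ≠ 0)
    (hU : AEMeasurable U μ) (hS : AEMeasurable S μ)
    (hlaw : μ.map (fun ω => (U ω, S ω - ρ * U ω)) = (gaussianReal 0 V).prod (gaussianReal 0 v))
    (x : ℝ) {ε : ℝ} (hε : 0 < ε) :
    |∫ ω, window x ε (U ω) * window x ε (S ω) ∂μ| ≤ (√V)⁻¹ * (√v)⁻¹ := by
  refine abs_integral_mul_le_of_regression hU hS hlaw (measurable_window x ε)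
    (measurable_window x ε) (abs_window_le hε x) (abs_window_le hε x) (fun c => ?_) ?_
  · rw [abs_of_nonneg (integral_nonneg fun w => window_nonneg hε _ _)]
    exact integral_window_gaussianReal_le hε x c hv
  · simp only [abs_of_nonneg (window_nonneg hε x _)]
    simpa using integral_window_gaussianReal_le hε x 0 hV

/-- Cancellation is used only in the factor of `S`; the factor of `U` is bounded by the triangle
inequality. One small factor is enough for a rate. -/
lemma abs_integral_window_sub_mul_le {U S : Ω → ℝ} {V v : ℝ≥0} {ρ : ℝ} (hV : V ≠ 0) (hv : v ≠ 0)
    (hU : AEMeasurable U μ) (hS : AEMeasurable S μ)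
    (hlaw : μ.map (fun ω => (U ω, S ω - ρ * U ω)) = (gaussianReal 0 V).prod (gaussianReal 0 v))
    (x : ℝ) {ε ε' m θ : ℝ} (hε : 0 < ε) (hε' : 0 < ε') (hm : ε ≤ m) (hm' : ε' ≤ m)
    (hθ0 : 0 ≤ θ) (hθ1 : θ ≤ 1) :
    |∫ ω, (window x ε (U ω) - window x ε' (U ω)) * (window x ε (S ω) - window x ε' (S ω)) ∂μ| ≤
      2 * (√V)⁻¹ * (2 * ((√v)⁻¹ * (m / √v) ^ θ)) := by
  have hb : ∀ y, |window x ε y - window x ε' y| ≤ 1 / (2 * ε) + 1 / (2 * ε') := fun y =>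
    (abs_sub _ _).trans (add_le_add (abs_window_le hε x y) (abs_window_le hε' x y))
  refine abs_integral_mul_le_of_regression hU hS hlaw
    (f := fun y => window x ε y - window x ε' y) (g := fun y => window x ε y - window x ε' y)
    ((measurable_window x ε).sub (measurable_window x ε'))
    ((measurable_window x ε).sub (measurable_window x ε')) hb hb (fun c => ?_) ?_
  · rw [integral_sub (integrable_window hε x c _) (integrable_window hε' x c _)]
    have h1 := abs_integral_window_sub_le hε hm x c hv hθ0 hθ1
    have h2 := abs_integral_window_sub_le hε' hm' x c hv hθ0 hθ1
    rw [abs_le] at h1 h2 ⊢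
    constructor <;> linarith [h1.1, h1.2, h2.1, h2.2]
  · have i1 : Integrable (window x ε) (gaussianReal 0 V) := by
      simpa using integrable_window hε x 0 (gaussianReal 0 V)
    have i2 : Integrable (window x ε') (gaussianReal 0 V) := by
      simpa using integrable_window hε' x 0 (gaussianReal 0 V)
    have h1 : ∫ u, window x ε u ∂gaussianReal 0 V ≤ (√V)⁻¹ := by
      simpa using integral_window_gaussianReal_le hε x 0 hV
    have h2 : ∫ u, window x ε' u ∂gaussianReal 0 V ≤ (√V)⁻¹ := by
      simpa using integral_window_gaussianReal_le hε' x 0 hV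
    calc ∫ u, |window x ε u - window x ε' u| ∂gaussianReal 0 V
        ≤ ∫ u, (window x ε u + window x ε' u) ∂gaussianReal 0 V := by
          refine integral_mono (i1.sub i2).abs (i1.add i2) fun u => ?_
          have := abs_sub (window x ε u) (window x ε' u)
          rwa [abs_of_nonneg (window_nonneg hε x u), abs_of_nonneg (window_nonneg hε' x u)] at this
      _ = (∫ u, window x ε u ∂gaussianReal 0 V) + ∫ u, window x ε' u ∂gaussianReal 0 V :=
          integral_add i1 i2
      _ ≤ 2 * (√V)⁻¹ := by linarith

end

/-! ### Almost sure limits as `ε ↓ 0`. -/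

/-- A function `Φ` for which `ε Φ(ε)` is monotone has a limit at `0+` as soon as it has one along
a sequence of powers. -/
lemma tendsto_of_tendsto_nat_rpow {Φ : ℝ → ℝ} {P l : ℝ} (hP : 0 < P) (h0 : ∀ ε, 0 < ε → 0 ≤ Φ ε)
    (hmono : ∀ ε ε', 0 < ε → ε ≤ ε' → ε * Φ ε ≤ ε' * Φ ε')
    (hl : Tendsto (fun k : ℕ => Φ ((k : ℝ) ^ (-P))) atTop (𝓝 l)) :
    Tendsto Φ (𝓝[>] 0) (𝓝 l) := by
  -- Chosen so that `(N + 1)^(-P) ≤ ε ≤ N^(-P)`. Monotonicity then squeezes `Φ ε` between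
  -- neighbouring values, up to ratios of consecutive powers, which tend to `1`.
  set N : ℝ → ℕ := fun ε => ⌊ε⁻¹ ^ (1 / P)⌋₊ with hN
  have hNt : Tendsto N (𝓝[>] 0) atTop :=
    tendsto_nat_floor_atTop.comp ((tendsto_rpow_atTop (by positivity)).comp
      tendsto_inv_nhdsGT_zero)
  have hratio : Tendsto (fun k : ℕ => (k : ℝ) ^ (-P) / ((k + 1 : ℕ) : ℝ) ^ (-P)) atTop (𝓝 1) := by
    have h1 : Tendsto (fun k : ℕ => (1 + 1 / (k : ℝ)) ^ P) atTop (𝓝 ((1 + 0) ^ P)) :=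
      (tendsto_const_nhds.add tendsto_one_div_atTop_nhds_zero_nat).rpow_const (Or.inr hP.le)
    rw [add_zero, Real.one_rpow] at h1
    refine h1.congr' ?_
    filter_upwards [eventually_gt_atTop 0] with k hk
    have hk' : (0 : ℝ) < k := by exact_mod_cast hk
    rw [← Real.div_rpow hk'.le (by positivity), Real.rpow_neg (by positivity),
      ← Real.inv_rpow (by positivity)]
    congr 1
    push_cast
    field_simp
  have hratio' : Tendsto (fun k : ℕ => ((k + 1 : ℕ) : ℝ) ^ (-P) / (k : ℝ) ^ (-P)) atTop (𝓝 1) := by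
    have := hratio.inv₀ one_ne_zero
    simpa [inv_div] using this
  have hlow := (hratio'.mul (hl.comp (tendsto_add_atTop_nat 1))).comp hNt
  have hup := (hratio.mul hl).comp hNt
  rw [one_mul] at hlow hup
  have hev : ∀ᶠ ε in 𝓝[>] (0 : ℝ), 0 < ε ∧ 0 < N ε := by
    filter_upwards [self_mem_nhdsWithin, hNt.eventually_gt_atTop 0] with ε h1 h2 using ⟨h1, h2⟩
  have hb : ∀ ε, 0 < ε → 0 < N ε →
      ((N ε + 1 : ℕ) : ℝ) ^ (-P) ≤ ε ∧ ε ≤ (N ε : ℝ) ^ (-P) := by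
    intro ε hε hNε
    have hx : 0 < ε⁻¹ ^ (1 / P) := by positivity
    have e : (ε⁻¹ ^ (1 / P)) ^ (-P) = ε := by
      rw [← Real.rpow_mul (by positivity), show 1 / P * -P = -1 by field_simp, Real.rpow_neg_one,
        inv_inv]
    have hN' : (0 : ℝ) < N ε := by exact_mod_cast hNε
    constructor
    · conv_rhs => rw [← e]
      refine Real.rpow_le_rpow_of_nonpos hx ?_ (by linarith)
      push_cast
      exact (Nat.lt_floor_add_one _).le
    · conv_lhs => rw [← e]
      exact Real.rpow_le_rpow_of_nonpos hN' (Nat.floor_le hx.le) (by linarith)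
  refine tendsto_of_tendsto_of_tendsto_of_le_of_le' hlow hup ?_ ?_
  · filter_upwards [hev] with ε ⟨hε, hNε⟩
    obtain ⟨h1, h2⟩ := hb ε hε hNε
    have hp : (0 : ℝ) < ((N ε + 1 : ℕ) : ℝ) ^ (-P) := by positivity
    have hq : (0 : ℝ) < (N ε : ℝ) ^ (-P) := hε.trans_le h2
    have h3 := hmono _ _ hp h1
    have h4 := mul_le_mul_of_nonneg_right h2 (h0 ε hε)
    simp only [Function.comp_apply]
    rw [div_mul_eq_mul_div, div_le_iff₀ hq]
    linarith
  · filter_upwards [hev] with ε ⟨hε, hNε⟩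
    obtain ⟨h1, h2⟩ := hb ε hε hNε
    have hp : (0 : ℝ) < ((N ε + 1 : ℕ) : ℝ) ^ (-P) := by positivity
    have h3 := hmono _ _ hε h2
    have h4 := mul_le_mul_of_nonneg_right h1 (h0 ε hε)
    simp only [Function.comp_apply]
    rw [div_mul_eq_mul_div, le_div_iff₀ hp]
    linarith

section

variable {Ω : Type*} [MeasurableSpace Ω] {μ : Measure Ω}

lemma eLpNorm_two_le_of_integral_sq_le {f : Ω → ℝ} (hf : MemLp f 2 μ) {A : ℝ}
    (h : ∫ ω, f ω ^ 2 ∂μ ≤ A) : eLpNorm f 2 μ ≤ ENNReal.ofReal (√A) := by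
  rw [hf.eLpNorm_eq_integral_rpow_norm (by norm_num) (by norm_num)]
  refine ENNReal.ofReal_le_ofReal ?_
  rw [Real.sqrt_eq_rpow]
  simp only [ENNReal.toReal_ofNat, Real.rpow_two, Real.norm_eq_abs, sq_abs]
  rw [one_div]
  exact Real.rpow_le_rpow (integral_nonneg fun _ => sq_nonneg _) h (by norm_num)

lemma integral_sq_le_of_eLpNorm_two_le {f : Ω → ℝ} (hf : MemLp f 2 μ) {A : ℝ} (hA : 0 ≤ A)
    (h : eLpNorm f 2 μ ≤ ENNReal.ofReal (√A)) : ∫ ω, f ω ^ 2 ∂μ ≤ A := by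
  rw [hf.eLpNorm_eq_integral_rpow_norm (by norm_num) (by norm_num),
    ENNReal.ofReal_le_ofReal_iff (Real.sqrt_nonneg _)] at h
  simp only [ENNReal.toReal_ofNat, Real.rpow_two, Real.norm_eq_abs, sq_abs] at h
  rw [← one_div, ← Real.sqrt_eq_rpow] at h
  exact (Real.sqrt_le_sqrt_iff hA).1 h

/-- Almost sure convergence at `0+` from a power rate in `L²` and monotonicity of `ε F_ε`. -/
lemma exists_limit_of_sq_rate {F : ℝ → Ω → ℝ} {A D θ : ℝ} (hθ : 0 < θ) (hA0 : 0 ≤ A)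
    (hD0 : 0 ≤ D) (hF : ∀ ε, 0 < ε → MemLp (F ε) 2 μ)
    (hA : ∀ ε, 0 < ε → ∫ ω, F ε ω ^ 2 ∂μ ≤ A)
    (hD : ∀ ε ε' m, 0 < ε → 0 < ε' → ε ≤ m → ε' ≤ m → ∫ ω, (F ε ω - F ε' ω) ^ 2 ∂μ ≤ D * m ^ θ)
    (h0 : ∀ ω ε, 0 < ε → 0 ≤ F ε ω)
    (hmono : ∀ ω ε ε', 0 < ε → ε ≤ ε' → ε * F ε ω ≤ ε' * F ε' ω) :
    (∀ᵐ ω ∂μ, Tendsto (fun ε => F ε ω) (𝓝[>] 0) (𝓝 (limUnder (𝓝[>] 0) fun ε => F ε ω))) ∧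
      MemLp (fun ω => limUnder (𝓝[>] 0) fun ε => F ε ω) 2 μ ∧
      ∫ ω, (limUnder (𝓝[>] 0) fun ε => F ε ω) ^ 2 ∂μ ≤ A := by
  -- With this power the squared `L²` distances are at most `D (N+1)^(-4)`, so the distances are
  -- summable. The factor `√(D + 1)` below only serves to make the inequality strict.
  set P : ℝ := 4 / θ with hP
  have hP0 : 0 < P := by positivity
  have hPθ : P * θ = 4 := by rw [hP]; field_simp
  set e : ℕ → ℝ := fun n => ((n + 1 : ℕ) : ℝ) ^ (-P) with he
  have he0 : ∀ n, 0 < e n := fun n => by positivity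
  have hanti : ∀ N n, N ≤ n → e n ≤ e N := fun N n h => by
    refine Real.rpow_le_rpow_of_nonpos (by positivity) ?_ (by linarith)
    exact_mod_cast (by omega : N + 1 ≤ n + 1)
  have hcau : ∀ᵐ ω ∂μ, ∃ l, Tendsto (fun n => F (e n) ω) atTop (𝓝 l) := by
    have hs : Summable fun N : ℕ => √(D + 1) * (1 / ((N + 1 : ℕ) : ℝ) ^ 2) := by
      refine Summable.mul_left _ ?_
      exact (summable_nat_add_iff 1).2 (Real.summable_one_div_nat_pow.2 one_lt_two)
    refine Lp.ae_tendsto_of_cauchy_eLpNorm (p := 2) (fun n => (hF _ (he0 n)).1) (by norm_num)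
      hs.tsum_ofReal_ne_top fun N n m hn hm => ?_
    have h1 : ∫ ω, (F (e n) - F (e m)) ω ^ 2 ∂μ ≤ D * e N ^ θ :=
      hD _ _ _ (he0 n) (he0 m) (hanti _ _ hn) (hanti _ _ hm)
    refine (eLpNorm_two_le_of_integral_sq_le ((hF _ (he0 n)).sub (hF _ (he0 m))) h1).trans_lt ?_
    rw [ENNReal.ofReal_lt_ofReal_iff (by positivity)]
    have h2 : e N ^ θ = (1 / ((N + 1 : ℕ) : ℝ) ^ 2) ^ 2 := by
      simp only [he]
      rw [← Real.rpow_mul (by positivity), neg_mul, hPθ, Real.rpow_neg (by positivity),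
        one_div, inv_pow, ← pow_mul]
      norm_cast
    rw [h2, Real.sqrt_mul hD0, Real.sqrt_sq (by positivity)]
    refine mul_lt_mul_of_pos_right (Real.sqrt_lt_sqrt hD0 (by linarith)) (by positivity)
  have hlim : ∀ᵐ ω ∂μ, Tendsto (fun ε => F ε ω) (𝓝[>] 0)
      (𝓝 (limUnder (𝓝[>] 0) fun ε => F ε ω)) := by
    filter_upwards [hcau] with ω ⟨l, hl⟩
    refine tendsto_nhds_limUnder ⟨l, tendsto_of_tendsto_nat_rpow hP0 (h0 ω) (hmono ω) ?_⟩
    exact (tendsto_add_atTop_iff_nat 1).1 hl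
  have het : Tendsto e atTop (𝓝[>] 0) := by
    refine tendsto_nhdsWithin_iff.2 ⟨?_, Eventually.of_forall he0⟩
    exact (tendsto_rpow_neg_atTop hP0).comp
      (tendsto_natCast_atTop_atTop.comp (tendsto_add_atTop_nat 1))
  have hlim' : ∀ᵐ ω ∂μ, Tendsto (fun n => F (e n) ω) atTop
      (𝓝 (limUnder (𝓝[>] 0) fun ε => F ε ω)) := by
    filter_upwards [hlim] with ω hω using hω.comp het
  have hmeas : ∀ n, AEStronglyMeasurable (F (e n)) μ := fun n => (hF _ (he0 n)).1
  have hnorm : eLpNorm (fun ω => limUnder (𝓝[>] 0) fun ε => F ε ω) 2 μ ≤ ENNReal.ofReal (√A) := by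
    -- Fatou's lemma passes the uniform second moment bound to the limit.
    refine (Lp.eLpNorm_lim_le_liminf_eLpNorm hmeas _ hlim').trans ?_
    refine (liminf_le_liminf (v := fun _ => ENNReal.ofReal (√A))
      (Eventually.of_forall fun n => ?_)).trans (liminf_const _).le
    exact eLpNorm_two_le_of_integral_sq_le (hF _ (he0 n)) (hA _ (he0 n))
  have hL : MemLp (fun ω => limUnder (𝓝[>] 0) fun ε => F ε ω) 2 μ :=
    ⟨aestronglyMeasurable_of_tendsto_ae atTop hmeas hlim', hnorm.trans_lt ENNReal.ofReal_lt_top⟩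
  exact ⟨hlim, hL, integral_sq_le_of_eLpNorm_two_le hL hA0 hnorm⟩

/-! ### Singular double integrals and second moments of time integrals. -/

/-- The singular weight `r^{-p} (s - r)^{-q}` on `r < s`. -/
def singularWeight (p q : ℝ) (z : ℝ × ℝ) : ℝ :=
  {z : ℝ × ℝ | z.1 < z.2}.indicator (fun z => z.1 ^ (-p) * (z.2 - z.1) ^ (-q)) z

lemma measurable_singularWeight (p q : ℝ) : Measurable (singularWeight p q) :=
  Measurable.indicator ((measurable_fst.pow_const _).mul
    ((measurable_snd.sub measurable_fst).pow_const _)) (measurableSet_lt measurable_fst measurable_snd)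

lemma integrable_singularWeight {p q t : ℝ} (hp : p < 1) (hq : q < 1) (ht : 0 ≤ t) :
    Integrable (singularWeight p q)
        ((volume.restrict (Ioc 0 t)).prod (volume.restrict (Ioc 0 t))) ∧
      ∫ z, singularWeight p q z ∂(volume.restrict (Ioc 0 t)).prod (volume.restrict (Ioc 0 t)) ≤
        t ^ (1 - p) / (1 - p) * (t ^ (1 - q) / (1 - q)) := by
  have hsec : ∀ r ∈ Ioc 0 t, IntegrableOn (fun s => singularWeight p q (r, s)) (Ioc 0 t) ∧
      ∫ s in Ioc 0 t, singularWeight p q (r, s) = r ^ (-p) * ((t - r) ^ (1 - q) / (1 - q)) := by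
    intro r hr
    have e : (fun s => singularWeight p q (r, s)) =
        (Ioi r).indicator fun s => r ^ (-p) * (s - r) ^ (-q) := by
      ext s
      rfl
    have e2 : Ioc 0 t ∩ Ioi r = Ioc r t := by
      ext s
      simp only [mem_inter_iff, mem_Ioc, mem_Ioi]
      constructor
      · rintro ⟨⟨h1, h2⟩, h3⟩
        exact ⟨h3, h2⟩
      · rintro ⟨h1, h2⟩
        exact ⟨⟨hr.1.trans h1, h2⟩, h1⟩
    have hi : IntervalIntegrable (fun s : ℝ => r ^ (-p) * (s - r) ^ (-q)) volume r t := by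
      have := (intervalIntegral.intervalIntegrable_rpow' (a := 0) (b := t - r)
        (show -1 < -q by linarith)).comp_sub_right r
      simp only [zero_add, sub_add_cancel] at this
      exact this.const_mul _
    constructor
    · rw [e, IntegrableOn, integrable_indicator_iff measurableSet_Ioi, IntegrableOn,
        Measure.restrict_restrict measurableSet_Ioi, inter_comm, e2]
      exact hi.1
    · rw [e, setIntegral_indicator measurableSet_Ioi, e2, ← intervalIntegral.integral_of_le hr.2,
        intervalIntegral.integral_const_mul,
        intervalIntegral.integral_comp_sub_right (fun x : ℝ => x ^ (-q)), sub_self,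
        integral_rpow (Or.inl (by linarith)), Real.zero_rpow (by linarith), sub_zero,
        show -q + 1 = 1 - q by ring]
  have hnn : ∀ r ∈ Ioc 0 t, ∀ s, 0 ≤ singularWeight p q (r, s) := fun r hr s => by
    by_cases h : r < s
    · rw [singularWeight, indicator_of_mem (show (r, s) ∈ {z : ℝ × ℝ | z.1 < z.2} from h)]
      exact mul_nonneg (Real.rpow_nonneg hr.1.le _) (Real.rpow_nonneg (sub_nonneg.2 h.le) _)
    · rw [singularWeight, indicator_of_notMem (show (r, s) ∉ {z : ℝ × ℝ | z.1 < z.2} from h)]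
  have hbi : IntegrableOn (fun r : ℝ => r ^ (-p) * (t ^ (1 - q) / (1 - q))) (Ioc 0 t) := by
    have := (intervalIntegral.intervalIntegrable_rpow' (a := 0) (b := t)
      (show -1 < -p by linarith)).1
    exact this.mul_const _
  have hle : ∀ r ∈ Ioc 0 t, r ^ (-p) * ((t - r) ^ (1 - q) / (1 - q)) ≤
      r ^ (-p) * (t ^ (1 - q) / (1 - q)) := fun r hr => by
    have h1 : 0 ≤ t - r := by linarith [hr.2]
    have h2 : t - r ≤ t := by linarith [hr.1]
    have h3 := hr.1
    have h4 : 0 < 1 - q := by linarith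
    gcongr
  have hi : IntegrableOn (fun r : ℝ => r ^ (-p) * ((t - r) ^ (1 - q) / (1 - q))) (Ioc 0 t) := by
    refine hbi.mono' (Measurable.aestronglyMeasurable (by fun_prop))
      ((ae_restrict_mem measurableSet_Ioc).mono fun r hr => ?_)
    have h1 : 0 ≤ t - r := by linarith [hr.2]
    have h3 := hr.1
    have h4 : 0 < 1 - q := by linarith
    rw [Real.norm_of_nonneg (by positivity)]
    exact hle r hr
  have hint : Integrable (singularWeight p q)
      ((volume.restrict (Ioc 0 t)).prod (volume.restrict (Ioc 0 t))) := by
    rw [integrable_prod_iff (measurable_singularWeight p q).aestronglyMeasurable]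
    refine ⟨(ae_restrict_mem measurableSet_Ioc).mono fun r hr => (hsec r hr).1, hi.congr ?_⟩
    refine (ae_restrict_mem measurableSet_Ioc).mono fun r hr => ?_
    simp only [Real.norm_of_nonneg (hnn r hr _)]
    exact (hsec r hr).2.symm
  refine ⟨hint, ?_⟩
  rw [integral_prod _ hint]
  calc ∫ r in Ioc 0 t, ∫ s in Ioc 0 t, singularWeight p q (r, s)
      = ∫ r in Ioc 0 t, r ^ (-p) * ((t - r) ^ (1 - q) / (1 - q)) :=
        setIntegral_congr_fun measurableSet_Ioc fun r hr => (hsec r hr).2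
    _ ≤ ∫ r in Ioc 0 t, r ^ (-p) * (t ^ (1 - q) / (1 - q)) :=
        setIntegral_mono_on hi hbi measurableSet_Ioc hle
    _ = t ^ (1 - p) / (1 - p) * (t ^ (1 - q) / (1 - q)) := by
        rw [integral_mul_const, ← intervalIntegral.integral_of_le ht,
          integral_rpow (Or.inl (by linarith)), Real.zero_rpow (by linarith), sub_zero,
          show -p + 1 = 1 - p by ring]

lemma ae_ne_prod (ν : Measure ℝ) [SFinite ν] [NullSingletonClass ν] :
    ∀ᵐ z ∂ν.prod ν, z.1 ≠ z.2 := by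
  rw [Measure.ae_prod_iff_ae_ae (p := fun z : ℝ × ℝ => z.1 ≠ z.2)
    (measurableSet_eq_fun measurable_fst measurable_snd).compl]
  refine Eventually.of_forall fun r => ?_
  filter_upwards [(countable_singleton r).ae_notMem ν] with s hs h
  exact hs h.symm

/-- The diagonal is null and the two triangles contribute equally by symmetry, whence the factor
`2`. -/
lemma abs_integral_prod_le_of_singular {φ : ℝ × ℝ → ℝ} {M p q t : ℝ} (hp : p < 1) (hq : q < 1)
    (ht : 0 ≤ t) (hM : 0 ≤ M) (hsymm : ∀ z, φ z.swap = φ z)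
    (h : ∀ r s, 0 < r → r < s → s ≤ t → |φ (r, s)| ≤ M * (r ^ (-p) * (s - r) ^ (-q))) :
    |∫ z, φ z ∂(volume.restrict (Ioc 0 t)).prod (volume.restrict (Ioc 0 t))| ≤
      2 * M * (t ^ (1 - p) / (1 - p) * (t ^ (1 - q) / (1 - q))) := by
  set ν : Measure ℝ := volume.restrict (Ioc 0 t)
  obtain ⟨hint, hle⟩ := integrable_singularWeight hp hq ht
  have hae : ∀ᵐ z ∂ν.prod ν,
      ‖φ z‖ ≤ M * (singularWeight p q z + singularWeight p q z.swap) := by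
    have hmem : ∀ᵐ z ∂ν.prod ν, z.1 ∈ Ioc 0 t ∧ z.2 ∈ Ioc 0 t := by
      rw [Measure.prod_restrict]
      exact (ae_restrict_mem (measurableSet_Ioc.prod measurableSet_Ioc)).mono fun z hz => hz
    filter_upwards [hmem, ae_ne_prod ν] with z hz hne
    have key : ∀ r s, 0 < r → r < s → s ≤ t →
        |φ (r, s)| ≤ M * (singularWeight p q (r, s) + singularWeight p q (s, r)) := by
      intro r s h1 h2 h3
      rw [singularWeight, singularWeight,
        indicator_of_mem (show (r, s) ∈ {z : ℝ × ℝ | z.1 < z.2} from h2),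
        indicator_of_notMem (show (s, r) ∉ {z : ℝ × ℝ | z.1 < z.2} from not_lt.2 h2.le), add_zero]
      exact h r s h1 h2 h3
    rcases lt_or_gt_of_ne hne with hlt | hlt
    · exact key _ _ hz.1.1 hlt hz.2.2
    · have := key _ _ hz.2.1 hlt hz.1.2
      rw [← hsymm z, add_comm]
      exact this
  have hswap : Integrable (fun z => singularWeight p q z.swap) (ν.prod ν) := hint.swap
  calc |∫ z, φ z ∂ν.prod ν|
      ≤ ∫ z, M * (singularWeight p q z + singularWeight p q z.swap) ∂ν.prod ν :=
        norm_integral_le_of_norm_le ((hint.add hswap).const_mul M) hae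
    _ = 2 * M * ∫ z, singularWeight p q z ∂ν.prod ν := by
        rw [integral_const_mul, integral_add hint hswap,
          integral_prod_swap (fun z => singularWeight p q z)]
        ring
    _ ≤ _ := mul_le_mul_of_nonneg_left hle (by positivity)

lemma bounded_weighted {w : ℝ → ℝ} {W C : ℝ} (hw0 : ∀ s, 0 ≤ w s) (hwW : ∀ s, w s ≤ W)
    {f : ℝ → ℝ} (hfC : ∀ y, |f y| ≤ C) (s y : ℝ) : ‖w s * f y‖ ≤ W * C := by
  rw [norm_mul, Real.norm_of_nonneg (hw0 s)]
  exact mul_le_mul (hwW s) (hfC y) (norm_nonneg _) ((hw0 s).trans (hwW s))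

/-- Second moment of a weighted time integral under a two-point bound. -/
lemma integral_sq_le_of_two_point [IsProbabilityMeasure μ] {Y : ℝ → Ω → ℝ}
    (hY : Measurable (Function.uncurry Y)) {w : ℝ → ℝ} (hw : Measurable w) {W C M p q t : ℝ}
    (hw0 : ∀ s, 0 ≤ w s) (hwW : ∀ s, w s ≤ W) {f : ℝ → ℝ} (hf : Measurable f)
    (hfC : ∀ y, |f y| ≤ C) (hp : p < 1) (hq : q < 1) (ht : 0 ≤ t) (hM : 0 ≤ M)
    (h : ∀ r s, 0 < r → r < s → s ≤ t →
      |∫ ω, f (Y r ω) * f (Y s ω) ∂μ| ≤ M * (r ^ (-p) * (s - r) ^ (-q))) :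
    ∫ ω, (∫ s in Ioc 0 t, w s * f (Y s ω)) ^ 2 ∂μ ≤
      2 * (W ^ 2 * M) * (t ^ (1 - p) / (1 - p) * (t ^ (1 - q) / (1 - q))) := by
  set ν : Measure ℝ := volume.restrict (Ioc 0 t)
  have hW : 0 ≤ W := (hw0 0).trans (hwW 0)
  have hg : Measurable fun z : ℝ × Ω => w z.1 * f (Y z.1 z.2) :=
    (hw.comp measurable_fst).mul (hf.comp hY)
  have hΦ : Measurable fun z : Ω × (ℝ × ℝ) =>
      w z.2.1 * f (Y z.2.1 z.1) * (w z.2.2 * f (Y z.2.2 z.1)) :=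
    (hg.comp ((measurable_fst.comp measurable_snd).prodMk measurable_fst)).mul
      (hg.comp ((measurable_snd.comp measurable_snd).prodMk measurable_fst))
  have hint : Integrable (fun z : Ω × (ℝ × ℝ) =>
      w z.2.1 * f (Y z.2.1 z.1) * (w z.2.2 * f (Y z.2.2 z.1))) (μ.prod (ν.prod ν)) := by
    refine Integrable.of_bound hΦ.aestronglyMeasurable (W * C * (W * C))
      (Eventually.of_forall fun z => ?_)
    rw [norm_mul]
    have h1 := bounded_weighted hw0 hwW hfC z.2.1 (Y z.2.1 z.1)
    have h2 := bounded_weighted hw0 hwW hfC z.2.2 (Y z.2.2 z.1)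
    exact mul_le_mul h1 h2 (norm_nonneg _) ((norm_nonneg _).trans h1)
  have hsq : ∀ ω, (∫ s, w s * f (Y s ω) ∂ν) ^ 2 =
      ∫ z, w z.1 * f (Y z.1 ω) * (w z.2 * f (Y z.2 ω)) ∂ν.prod ν := fun ω => by
    rw [integral_prod_mul (fun s => w s * f (Y s ω)) (fun s => w s * f (Y s ω)), sq]
  simp only [hsq]
  rw [integral_integral_swap (f := fun ω (z : ℝ × ℝ) =>
    w z.1 * f (Y z.1 ω) * (w z.2 * f (Y z.2 ω))) hint]
  have hφ : ∀ z : ℝ × ℝ, ∫ ω, w z.1 * f (Y z.1 ω) * (w z.2 * f (Y z.2 ω)) ∂μ =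
      w z.1 * w z.2 * ∫ ω, f (Y z.1 ω) * f (Y z.2 ω) ∂μ := fun z => by
    rw [← integral_const_mul]
    congr 1
    ext ω
    ring
  refine (le_abs_self _).trans (abs_integral_prod_le_of_singular hp hq ht (by positivity)
    (fun z => ?_) fun r s hr hrs hst => ?_)
  · refine integral_congr_ae (Eventually.of_forall fun ω => ?_)
    simp only [Prod.fst_swap, Prod.snd_swap]
    ring
  · have e := hφ (r, s)
    simp only at e ⊢
    rw [e, abs_mul, abs_mul, abs_of_nonneg (hw0 r), abs_of_nonneg (hw0 s)]
    have h1 : w r * w s ≤ W ^ 2 := by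
      rw [sq]
      exact mul_le_mul (hwW r) (hwW s) (hw0 s) hW
    calc w r * w s * |∫ ω, f (Y r ω) * f (Y s ω) ∂μ|
        ≤ W ^ 2 * (M * (r ^ (-p) * (s - r) ^ (-q))) :=
          mul_le_mul h1 (h r s hr hrs hst) (abs_nonneg _) (by positivity)
      _ = _ := by ring

lemma memLp_weighted [IsProbabilityMeasure μ] {Y : ℝ → Ω → ℝ}
    (hY : Measurable (Function.uncurry Y)) {w : ℝ → ℝ} (hw : Measurable w) {W C t : ℝ}
    (hw0 : ∀ s, 0 ≤ w s) (hwW : ∀ s, w s ≤ W) {f : ℝ → ℝ} (hf : Measurable f)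
    (hfC : ∀ y, |f y| ≤ C) : MemLp (fun ω => ∫ s in Ioc 0 t, w s * f (Y s ω)) 2 μ := by
  have hg : Measurable fun z : Ω × ℝ => w z.2 * f (Y z.2 z.1) :=
    (hw.comp measurable_snd).mul (hf.comp (hY.comp (measurable_snd.prodMk measurable_fst)))
  refine MemLp.of_bound (C := W * C * volume.real (Ioc 0 t))
    (hg.stronglyMeasurable.integral_prod_right' (ν := volume.restrict (Ioc 0 t))).aestronglyMeasurable
    (Eventually.of_forall fun ω => ?_)
  exact norm_setIntegral_le_of_norm_le_const measure_Ioc_lt_top fun s _ =>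
    bounded_weighted hw0 hwW hfC s _

end

/-! ### Local times under local nondeterminism, and its verification for the solution. -/

section

variable {Ω : Type*} [MeasurableSpace Ω] {μ : Measure Ω}

/-- Existence and second moment of the weighted local time under local nondeterminism. -/
lemma local_time_of_regression [IsProbabilityMeasure μ] {Y : ℝ → Ω → ℝ}
    (hY : Measurable (Function.uncurry Y)) {w : ℝ → ℝ} (hw : Measurable w) {W b H t : ℝ}
    (hw0 : ∀ s, 0 ≤ w s) (hwW : ∀ s, w s ≤ W) (hb : 0 < b) (hH : 1 / 2 < H) (hH' : H < 1)
    (ht : 0 ≤ t)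
    (hreg : ∀ r s, 0 < r → r < s → s ≤ t → ∃ (ρ : ℝ) (V v : ℝ≥0),
      b * r ^ H ≤ √V ∧ b * (s - r) ^ H ≤ √v ∧
      μ.map (fun ω => (Y r ω, Y s ω - ρ * Y r ω)) = (gaussianReal 0 V).prod (gaussianReal 0 v))
    (x : ℝ) {F : ℝ → Ω → ℝ} (hFdef : F = fun ε ω => ∫ s in Ioc 0 t, w s * window x ε (Y s ω)) :
    (∀ᵐ ω ∂μ, Tendsto (fun ε => F ε ω) (𝓝[>] 0) (𝓝 (limUnder (𝓝[>] 0) fun ε => F ε ω))) ∧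
      MemLp (fun ω => limUnder (𝓝[>] 0) fun ε => F ε ω) 2 μ ∧
      ∫ ω, (limUnder (𝓝[>] 0) fun ε => F ε ω) ^ 2 ∂μ ≤
        2 * (W ^ 2 * (b⁻¹ * b⁻¹)) * (t ^ (1 - H) / (1 - H) * (t ^ (1 - H) / (1 - H))) := by
  have hW : 0 ≤ W := (hw0 0).trans (hwW 0)
  -- The rate raises the singularity from `(s - r)^(-H)` to `(s - r)^(-H(1+θ))`; this choice puts
  -- the new exponent halfway between `H` and `1`.
  set θ : ℝ := (1 - H) / (2 * H) with hθ
  have hθ0 : 0 < θ := div_pos (by linarith) (by linarith)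
  have hθ1 : θ ≤ 1 := by
    rw [hθ, div_le_one (by linarith)]
    linarith
  have hHθ : H * (1 + θ) = (1 + H) / 2 := by
    rw [hθ]
    field_simp
    ring
  have hYm : ∀ s, Measurable (Y s) := fun s => hY.comp (measurable_const.prodMk measurable_id)
  have hinv : ∀ {d y : ℝ}, 0 < d → b * d ^ H ≤ y → 0 < y ∧ y⁻¹ ≤ b⁻¹ * d ^ (-H) := by
    intro d y hd hy
    have h1 : 0 < b * d ^ H := by positivity
    refine ⟨h1.trans_le hy, (inv_anti₀ h1 hy).trans (le_of_eq ?_)⟩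
    rw [mul_inv, Real.rpow_neg hd.le]
  have hne : ∀ {v : ℝ≥0}, 0 < √(v : ℝ) → v ≠ 0 := fun h h0 => by simp [h0] at h
  have hq1 : (1 + H) / 2 < 1 := by linarith
  have hker1 : 0 ≤ t ^ (1 - H) / (1 - H) := div_nonneg (Real.rpow_nonneg ht _) (by linarith)
  have hker2 : 0 ≤ t ^ (1 - (1 + H) / 2) / (1 - (1 + H) / 2) :=
    div_nonneg (Real.rpow_nonneg ht _) (by linarith)
  have hlin : ∀ ω ε ε', 0 < ε → 0 < ε' → F ε ω - F ε' ω =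
      ∫ s in Ioc 0 t, w s * (window x ε (Y s ω) - window x ε' (Y s ω)) := by
    intro ω ε ε' hε hε'
    have hi : ∀ ε, 0 < ε → IntegrableOn (fun s => w s * window x ε (Y s ω)) (Ioc 0 t) :=
      fun ε hε => Integrable.of_bound (hw.mul ((measurable_window x ε).comp
        (hY.comp measurable_prodMk_right))).aestronglyMeasurable _
        (Eventually.of_forall fun s => bounded_weighted hw0 hwW (abs_window_le hε x) s _)
    simp only [hFdef, mul_sub]
    exact (integral_sub (hi ε hε) (hi ε' hε')).symm
  refine exists_limit_of_sq_rate (D := 2 * (W ^ 2 * (4 * (b⁻¹ * b⁻¹ * b⁻¹ ^ θ))) *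
    (t ^ (1 - H) / (1 - H) * (t ^ (1 - (1 + H) / 2) / (1 - (1 + H) / 2)))) hθ0
    (by positivity) (by positivity) (fun ε hε => ?_) (fun ε hε => ?_)
    (fun ε ε' m hε hε' hm hm' => ?_) (fun ω ε hε => ?_) (fun ω ε ε' hε hεε' => ?_)
  · rw [hFdef]
    exact memLp_weighted hY hw hw0 hwW (measurable_window x ε) (abs_window_le hε x)
  · rw [hFdef]
    refine integral_sq_le_of_two_point hY hw hw0 hwW (measurable_window x ε) (abs_window_le hε x)
      hH' hH' ht (by positivity) fun r s hr hrs hst => ?_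
    obtain ⟨ρ, V, v, hV, hv, hlaw⟩ := hreg r s hr hrs hst
    obtain ⟨hV0, hV1⟩ := hinv hr hV
    obtain ⟨hv0, hv1⟩ := hinv (sub_pos.2 hrs) hv
    refine (integral_window_mul_window_le (hne hV0) (hne hv0) (hYm r).aemeasurable
      (hYm s).aemeasurable hlaw x hε).trans ?_
    calc (√(V : ℝ))⁻¹ * (√(v : ℝ))⁻¹ ≤ (b⁻¹ * r ^ (-H)) * (b⁻¹ * (s - r) ^ (-H)) := by gcongr
      _ = _ := by ring
  · have hm0 : 0 < m := hε.trans_le hm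
    simp only [hlin _ ε ε' hε hε']
    have hb2 : ∀ y, |window x ε y - window x ε' y| ≤ 1 / (2 * ε) + 1 / (2 * ε') := fun y =>
      (abs_sub _ _).trans (add_le_add (abs_window_le hε x y) (abs_window_le hε' x y))
    refine (integral_sq_le_of_two_point hY hw hw0 hwW (M := 4 * (b⁻¹ * b⁻¹ * b⁻¹ ^ θ) * m ^ θ)
      (f := fun y => window x ε y - window x ε' y)
      ((measurable_window x ε).sub (measurable_window x ε')) hb2 hH' hq1 ht (by positivity)
      fun r s hr hrs hst => ?_).trans (le_of_eq (by ring))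
    obtain ⟨ρ, V, v, hV, hv, hlaw⟩ := hreg r s hr hrs hst
    have hd : 0 < s - r := sub_pos.2 hrs
    obtain ⟨hV0, hV1⟩ := hinv hr hV
    obtain ⟨hv0, hv1⟩ := hinv hd hv
    refine (abs_integral_window_sub_mul_le (hne hV0) (hne hv0) (hYm r).aemeasurable
      (hYm s).aemeasurable hlaw x hε hε' hm hm' hθ0.le hθ1).trans ?_
    have h1 : (m / √(v : ℝ)) ^ θ ≤ m ^ θ * (b⁻¹ ^ θ * (s - r) ^ (-(H * θ))) := by
      rw [div_eq_mul_inv, Real.mul_rpow hm0.le (by positivity)]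
      refine mul_le_mul_of_nonneg_left ?_ (by positivity)
      refine (Real.rpow_le_rpow (by positivity) hv1 hθ0.le).trans (le_of_eq ?_)
      rw [Real.mul_rpow (by positivity) (by positivity), ← Real.rpow_mul hd.le, neg_mul]
    calc 2 * (√(V : ℝ))⁻¹ * (2 * ((√(v : ℝ))⁻¹ * (m / √(v : ℝ)) ^ θ))
        ≤ 2 * (b⁻¹ * r ^ (-H)) * (2 * ((b⁻¹ * (s - r) ^ (-H)) *
          (m ^ θ * (b⁻¹ ^ θ * (s - r) ^ (-(H * θ)))))) := by gcongr
      _ = 4 * (b⁻¹ * b⁻¹ * b⁻¹ ^ θ) * m ^ θ *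
          (r ^ (-H) * ((s - r) ^ (-H) * (s - r) ^ (-(H * θ)))) := by ring
      _ = _ := by
          rw [← Real.rpow_add hd, show -H + -(H * θ) = -((1 + H) / 2) by rw [← hHθ]; ring]
  · rw [hFdef]
    exact integral_nonneg fun s => mul_nonneg (hw0 s) (window_nonneg hε _ _)
  · have hε' : 0 < ε' := hε.trans_le hεε'
    -- Multiplied by `ε`, the approximation is half the weighted occupation of `[x - ε, x + ε]`,
    -- hence monotone in `ε`.
    have e : ∀ ε, 0 < ε → ε * F ε ω =
        ∫ s in Ioc 0 t, w s * (1 / 2 * (Icc (x - ε) (x + ε)).indicator (fun _ => (1 : ℝ)) (Y s ω)) := by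
      intro ε hε
      rw [hFdef, ← integral_const_mul]
      congr 1
      ext s
      rw [window]
      field_simp
    have hi : ∀ ε : ℝ, IntegrableOn (fun s => w s * (1 / 2 *
        (Icc (x - ε) (x + ε)).indicator (fun _ => (1 : ℝ)) (Y s ω))) (Ioc 0 t) := by
      intro ε
      refine Integrable.of_bound (hw.mul (((measurable_const.indicator measurableSet_Icc).comp
        (hY.comp measurable_prodMk_right)).const_mul _)).aestronglyMeasurable _
        (Eventually.of_forall fun s => bounded_weighted hw0 hwW (C := 1)
          (f := fun y => 1 / 2 * (Icc (x - ε) (x + ε)).indicator (fun _ => (1 : ℝ)) y)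
          (fun y => ?_) s _)
      by_cases hy : y ∈ Icc (x - ε) (x + ε)
      · rw [indicator_of_mem hy]
        norm_num
      · rw [indicator_of_notMem hy]
        norm_num
    rw [e ε hε, e ε' hε']
    refine integral_mono (hi ε) (hi ε') fun s => ?_
    have h1 : Icc (x - ε) (x + ε) ⊆ Icc (x - ε') (x + ε') := Icc_subset_Icc (by linarith) (by linarith)
    have h2 := indicator_le_indicator_of_subset h1 (f := fun _ : ℝ => (1 : ℝ))
      (fun _ => zero_le_one) (Y s ω)
    have h3 := hw0 s
    simp only
    gcongr

/-- A process with continuous paths on `[0, T]` has a jointly measurable version. -/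
lemma exists_measurable_version {X : ℝ → Ω → ℝ} {T : ℝ} (hT : 0 ≤ T)
    (hX : ∀ t ∈ Icc 0 T, AEMeasurable (X t) μ)
    (hc : ∀ᵐ ω ∂μ, ContinuousOn (fun t => X t ω) (Icc 0 T)) :
    ∃ Y : ℝ → Ω → ℝ, Measurable (Function.uncurry Y) ∧
      ∀ᵐ ω ∂μ, ∀ s ∈ Icc 0 T, Y s ω = X s ω := by
  set p : ℝ → ℝ := fun s => projIcc 0 T hT s with hp
  have hpc : Continuous p := continuous_subtype_val.comp continuous_projIcc
  have hpm : ∀ s, p s ∈ Icc 0 T := fun s => (projIcc 0 T hT s).2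
  -- Each `X t` is only almost everywhere measurable. Rational times give countably many exceptional
  -- sets, and off them path continuity transfers measurability to every time.
  have hae : ∀ᵐ ω ∂μ, ContinuousOn (fun t => X t ω) (Icc 0 T) ∧
      ∀ q : ℚ, X (p q) ω = (hX _ (hpm q)).mk _ ω :=
    hc.and (ae_all_iff.2 fun q => (hX _ (hpm q)).ae_eq_mk)
  obtain ⟨S, hSae, hSm, hS⟩ := hae.exists_measurable_mem
  refine ⟨fun s => S.indicator (X (p s)), ?_, ?_⟩
  · have hcont : ∀ ω, Continuous fun s => S.indicator (X (p s)) ω := fun ω => by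
      by_cases hω : ω ∈ S
      · simp only [indicator_of_mem hω]
        exact (hS ω hω).1.comp_continuous hpc hpm
      · simp only [indicator_of_notMem hω]
        exact continuous_const
    refine measurable_uncurry_of_continuous_of_measurable hcont fun s => ?_
    obtain ⟨u, hu, hus⟩ := mem_closure_iff_seq_limit.1 (Rat.denseRange_cast (𝕜 := ℝ) s)
    refine measurable_of_tendsto_metrizable (f := fun n => S.indicator (X (p (u n)))) (fun n => ?_)
      (tendsto_pi_nhds.2 fun ω => ((hcont ω).tendsto s).comp hus)
    obtain ⟨q, hq⟩ := hu n
    rw [← hq]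
    have e : S.indicator (X (p q)) = S.indicator ((hX _ (hpm q)).mk _) :=
      indicator_congr fun ω hω => (hS ω hω).2 q
    rw [e]
    exact (hX _ (hpm q)).measurable_mk.indicator hSm
  · filter_upwards [hSae] with ω hω s hs
    rw [indicator_of_mem hω]
    simp only [hp, projIcc_of_mem hT hs]

lemma deltaApprox_eq (w y : ℝ → ℝ) {t : ℝ} (ht : 0 ≤ t) (x ε : ℝ) :
    deltaApprox w y t x ε =
      ∫ s in Ioc 0 t, (Ioc 0 t).indicator w s * window x ε (y s) := by
  rw [deltaApprox, intervalIntegral.integral_of_le ht, ← integral_const_mul]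
  refine setIntegral_congr_fun measurableSet_Ioc fun s hs => ?_
  simp only [indicator_of_mem hs, window]
  ring

/-- Local nondeterminism of the solution in terms of the regression on its past values. -/
lemma exists_regression_of_isSolution [IsProbabilityMeasure μ] {a H T : ℝ} (ha : 0 < a)
    (hα : 0 < H - 1 / 2) (hα1 : H - 1 / 2 < 1 / 2) {B X Y : ℝ → Ω → ℝ}
    (hB : IsFractionalBrownianMotion H B μ) (hX : IsSolution a 0 T B X μ)
    (hY : ∀ s, Measurable (Y s)) (hYX : ∀ᵐ ω ∂μ, ∀ s ∈ Icc 0 T, Y s ω = X s ω)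
    {r s : ℝ} (hr : 0 < r) (hrs : r < s) (hsT : s ≤ T) :
    ∃ (ρ : ℝ) (V v : ℝ≥0),
      Real.exp (-(a * T ^ 2 / 2)) / (H + 1 / 2) / √(fracConst (H - 1 / 2)) * r ^ H ≤ √V ∧
      Real.exp (-(a * T ^ 2 / 2)) / (H + 1 / 2) / √(fracConst (H - 1 / 2)) * (s - r) ^ H ≤ √v ∧
      μ.map (fun ω => (Y r ω, Y s ω - ρ * Y r ω)) =
        (gaussianReal 0 V).prod (gaussianReal 0 v) := by
  have hc := fracConst_pos hα hα1
  have hcov : ∀ t s : ℝ, 0 ≤ t → 0 ≤ s → ∫ ω, B t ω * B s ω ∂μ =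
      inner ℝ (fracVec hα hα1 t) (fracVec hα hα1 s) / fracConst (H - 1 / 2) := by
    intro t s ht hs
    rw [inner_fracVec, mul_div_cancel_left₀ _ hc.ne', hB.covariance t s ht hs, abs_of_nonneg ht,
      abs_of_nonneg hs, show 2 * (H - 1 / 2) + 1 = 2 * H by ring]
  have hform : ∀ u ∈ Icc 0 T, ∀ᵐ ω ∂μ,
      Y u ω = B u ω + ∫ v in (0 : ℝ)..u, volterraKernel a u v * B v ω := by
    intro u hu
    filter_upwards [hX.continuous, hX.equation, hYX] with ω h1 h2 h3
    rw [h3 u hu]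
    exact solution_formula (b := fun t => B t ω) h1 (fun t ht => by simpa using h2 t ht) hu
  have hrT : r ∈ Icc 0 T := ⟨hr.le, hrs.le.trans hsT⟩
  have hsT' : s ∈ Icc 0 T := ⟨(hr.trans hrs).le, hsT⟩
  have hlaw := map_volterra_combination hc hB.gaussian hB.centered hcov hB.continuous
    (continuous_fracVec hα hα1) hr.le (hr.trans hrs).le (hY r).aemeasurable (hY s).aemeasurable
    (hform r hrT) (hform s hsT')
  -- Nondeterminism on `(0, r]` with coefficient `0` bounds the variance of `X_r` itself from below.
  have hsolr := le_norm_solVec_sub hα hα1 ha le_rfl hr hrT.2 0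
  rw [zero_smul, sub_zero, sub_zero] at hsolr
  have hk : solVec hα hα1 a r ≠ 0 := by
    intro h
    rw [h, norm_zero] at hsolr
    have : 0 < Real.exp (-(a * T ^ 2 / 2)) / (H - 1 / 2 + 1) * r ^ (H - 1 / 2 + 1 / 2) := by
      positivity
    linarith
  obtain ⟨ρ, hρ⟩ := map_regression hc hk (hY r).aemeasurable (hY s).aemeasurable hlaw
  refine ⟨ρ, _, _, ?_, ?_, hρ⟩
  · rw [Real.coe_toNNReal _ (by positivity), Real.sqrt_div' _ hc.le, Real.sqrt_sq (norm_nonneg _),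
      div_mul_eq_mul_div]
    rw [show H - 1 / 2 + 1 = H + 1 / 2 by ring, show H - 1 / 2 + 1 / 2 = H by ring] at hsolr
    gcongr
  · have hsol := le_norm_solVec_sub hα hα1 ha hr.le hrs hsT ρ
    rw [show H - 1 / 2 + 1 = H + 1 / 2 by ring, show H - 1 / 2 + 1 / 2 = H by ring] at hsol
    rw [Real.coe_toNNReal _ (by positivity), Real.sqrt_div' _ hc.le, Real.sqrt_sq (norm_nonneg _),
      div_mul_eq_mul_div]
    gcongr
    exact hsol

end

/-- The weighted local time of the solution exists, with a bound on its second moment. -/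
lemma deltaIntegral_of_isSolution {Ω : Type*} [MeasurableSpace Ω] {μ : Measure Ω}
    [IsProbabilityMeasure μ] {a H T : ℝ} (ha : 0 < a)
    (hH : 1 / 2 < H) (hH' : H < 1) {B X : ℝ → Ω → ℝ}
    (hB : IsFractionalBrownianMotion H B μ) (hX : IsSolution a 0 T B X μ) {t : ℝ}
    (ht : t ∈ Icc 0 T) {w : ℝ → ℝ} (hw : Measurable w) {W b : ℝ}
    (hb : b = Real.exp (-(a * T ^ 2 / 2)) / (H + 1 / 2) / √(fracConst (H - 1 / 2)))
    (hb0 : 0 < b) (hW : 0 ≤ W)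
    (hw0 : ∀ s ∈ Ioc 0 t, 0 ≤ w s) (hwW : ∀ s ∈ Ioc 0 t, w s ≤ W) (x : ℝ) :
    (∀ᵐ ω ∂μ, Tendsto (deltaApprox w (fun s => X s ω) t x) (𝓝[>] 0)
        (𝓝 (deltaIntegral w (fun s => X s ω) t x))) ∧
      MemLp (fun ω => deltaIntegral w (fun s => X s ω) t x) 2 μ ∧
      ∫ ω, deltaIntegral w (fun s => X s ω) t x ^ 2 ∂μ ≤
        2 * (W ^ 2 * (b⁻¹ * b⁻¹)) * (t ^ (1 - H) / (1 - H) * (t ^ (1 - H) / (1 - H))) := by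
  obtain ⟨Y, hY, hYX⟩ := exists_measurable_version (ht.1.trans ht.2) hX.aemeasurable hX.continuous
  have hYm : ∀ s, Measurable (Y s) := fun s => hY.comp (measurable_const.prodMk measurable_id)
  -- Cutting the weight off outside `(0, t]` makes its bounds global without changing the integrals.
  have hw0' : ∀ s, 0 ≤ (Ioc 0 t).indicator w s := fun s => indicator_nonneg hw0 s
  have hwW' : ∀ s, (Ioc 0 t).indicator w s ≤ W := fun s => indicator_le' hwW (fun _ _ => hW) s
  obtain ⟨h1, h2, h3⟩ := local_time_of_regression hY (hw.indicator measurableSet_Ioc) hw0' hwW'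
    hb0 hH hH' ht.1 (fun r s hr hrs hst => by
      rw [hb]
      exact exists_regression_of_isSolution ha (by linarith) (by linarith) hB hX hYm hYX hr hrs
        (hst.trans ht.2)) x rfl
  have heq : ∀ᵐ ω ∂μ, (fun ε => ∫ s in Ioc 0 t, (Ioc 0 t).indicator w s * window x ε (Y s ω)) =
      deltaApprox w (fun s => X s ω) t x := by
    filter_upwards [hYX] with ω hω
    ext ε
    rw [deltaApprox_eq w _ ht.1]
    refine setIntegral_congr_fun measurableSet_Ioc fun s hs => ?_
    simp only [hω s ⟨hs.1.le, hs.2.trans ht.2⟩]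
  have hlim : (fun ω => limUnder (𝓝[>] 0) fun ε =>
      ∫ s in Ioc 0 t, (Ioc 0 t).indicator w s * window x ε (Y s ω)) =ᵐ[μ]
      fun ω => deltaIntegral w (fun s => X s ω) t x := by
    filter_upwards [heq] with ω hω
    rw [hω, deltaIntegral]
  refine ⟨?_, h2.ae_eq hlim, ?_⟩
  · filter_upwards [h1, heq] with ω hω he
    rw [he] at hω
    exact hω
  · refine (integral_congr_ae ?_).trans_le h3
    filter_upwards [hlim] with ω hω
    rw [hω]

end FracDiffusion

end

theorem proposition3p2 (a H T : ℝ) (ha : 0 < a) (hH : 1 / 2 < H) (hH' : H < 1) (hT : 0 < T) :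
    ∃ C : ℝ, 0 < C ∧
      ∀ (Ω : Type*) [MeasurableSpace Ω] (μ : Measure Ω) [IsProbabilityMeasure μ]
        (B X : ℝ → Ω → ℝ),
        FracDiffusion.IsFractionalBrownianMotion H B μ →
        FracDiffusion.IsSolution a 0 T B X μ →
        ∀ t ∈ Icc 0 T, ∀ x : ℝ,
          -- the local time exists, is square integrable and satisfies the bound
          ((∀ᵐ ω ∂μ, Tendsto
              (FracDiffusion.deltaApprox (fun _ => 1) (fun s => X s ω) t x)
              (𝓝[>] 0) (𝓝 (FracDiffusion.localTime X t x ω))) ∧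
            MemLp (FracDiffusion.localTime X t x) 2 μ ∧
            ∫ ω, (FracDiffusion.localTime X t x ω) ^ 2 ∂μ ≤ C * t ^ (2 - 2 * H)) ∧
          -- the weighted local time exists, is square integrable and satisfies the bound
          ((∀ᵐ ω ∂μ, Tendsto
              (FracDiffusion.deltaApprox (FracDiffusion.weight a H) (fun s => X s ω) t x)
              (𝓝[>] 0) (𝓝 (FracDiffusion.weightedLocalTime a H X t x ω))) ∧
            MemLp (FracDiffusion.weightedLocalTime a H X t x) 2 μ ∧
            ∫ ω, (FracDiffusion.weightedLocalTime a H X t x ω) ^ 2 ∂μ ≤ C * t ^ (2 * H)) := by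
  have hα : 0 < H - 1 / 2 := by linarith
  have hα1 : H - 1 / 2 < 1 / 2 := by linarith
  have hc := FracDiffusion.fracConst_pos hα hα1
  obtain ⟨b, hb⟩ : ∃ b, b = Real.exp (-(a * T ^ 2 / 2)) / (H + 1 / 2) /
      √(FracDiffusion.fracConst (H - 1 / 2)) := ⟨_, rfl⟩
  have hH0 : 0 < H := by linarith
  have hb0 : 0 < b := by
    rw [hb]
    positivity
  have h1H : 0 < 1 - H := by linarith
  -- The unweighted case needs only `2`; the weighted one has `2 (2H)² = 8H² ≤ 8`.
  refine ⟨8 * (b⁻¹ * b⁻¹) / (1 - H) ^ 2, by positivity, ?_⟩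
  intro Ω _ μ _ B X hB hX t ht x
  have ht0 : 0 ≤ t := ht.1
  have hpow : t ^ (1 - H) * t ^ (1 - H) = t ^ (2 - 2 * H) := by
    rw [← Real.rpow_add_of_nonneg ht0 h1H.le h1H.le]
    congr 1
    ring
  constructor
  · obtain ⟨h1, h2, h3⟩ := FracDiffusion.deltaIntegral_of_isSolution ha hH hH' hB hX ht
      (w := fun _ => 1) measurable_const hb hb0 zero_le_one (fun _ _ => zero_le_one)
      (fun _ _ => le_rfl) x
    refine ⟨h1, h2, h3.trans ?_⟩
    calc 2 * ((1 : ℝ) ^ 2 * (b⁻¹ * b⁻¹)) * (t ^ (1 - H) / (1 - H) * (t ^ (1 - H) / (1 - H)))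
        = 2 * (b⁻¹ * b⁻¹) / (1 - H) ^ 2 * (t ^ (1 - H) * t ^ (1 - H)) := by
          field_simp
      _ ≤ _ := by
          rw [hpow]
          gcongr
          norm_num
  · have hp : 0 ≤ 2 * H - 1 := by linarith
    obtain ⟨h1, h2, h3⟩ := FracDiffusion.deltaIntegral_of_isSolution ha hH hH' hB hX ht
      -- A bound for the weight on all of `(0, t]`, because `2H - 1 ≥ 0`. Letting it depend on `t`
      -- gives the exponent `2(2H - 1) + (2 - 2H) = 2H`.
      (w := FracDiffusion.weight a H) (W := 2 * H * t ^ (2 * H - 1))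
      (FracDiffusion.measurable_weight a H) hb hb0 (by positivity)
      (fun s hs => FracDiffusion.weight_nonneg ha hH hs.1.le)
      (fun s hs => (FracDiffusion.weight_le ha hH hs.1.le).trans (by
        have := hs.1
        have := hs.2
        gcongr)) x
    refine ⟨h1, h2, h3.trans ?_⟩
    have hpow2 : t ^ (2 * H - 1) * t ^ (2 * H - 1) * t ^ (2 - 2 * H) = t ^ (2 * H) := by
      rw [← Real.rpow_add_of_nonneg ht0 hp hp,
        ← Real.rpow_add_of_nonneg ht0 (by linarith) (by linarith)]
      congr 1
      ring
    calc 2 * ((2 * H * t ^ (2 * H - 1)) ^ 2 * (b⁻¹ * b⁻¹)) *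
          (t ^ (1 - H) / (1 - H) * (t ^ (1 - H) / (1 - H)))
        = 8 * (b⁻¹ * b⁻¹) / (1 - H) ^ 2 *
          (t ^ (2 * H - 1) * t ^ (2 * H - 1) * (t ^ (1 - H) * t ^ (1 - H))) * H ^ 2 := by
          field_simp
          ring
      _ = 8 * (b⁻¹ * b⁻¹) / (1 - H) ^ 2 * t ^ (2 * H) * H ^ 2 := by rw [hpow, hpow2]
      _ ≤ _ := mul_le_of_le_one_right (by positivity) (pow_le_one₀ hH0.le hH'.le)
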